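/- **Setting.** Let $m,d,K$ be integers, $d,K\ge 1$. Let $\mathcal E\subseteq\mathbb R^d$ be a closed cone equal to the closure of its interior, $\mathcal X\subseteq\mathbb R^m$ a closed cone ($t\boldsymbol x\in\mathcal X$ for $\boldsymbol x\in\mathcal X$, $t>0$), and $g_1,\dots,g_K:\mathbb R^m\times\mathbb R^d\to[-\infty,\infty]$ lower semicontinuous. Put $g=\max_k g_k$, $\mathcal S(\boldsymbol x)=\{\boldsymbol z\in\mathcal E: g(\boldsymbol x,\boldsymbol z)\le 0\}$ and $\mathcal X'=\{\boldsymbol x\in\mathcal X:\operatorname{int}\mathcal S(\boldsymbol x)\ne\emptyset\}$. A set-valued map $S$ is *non-vacuous* if $\mathcal E\setminus S(\boldsymbol x)\neq\emptyset$ for all $\boldsymbol x\in\mathcal X$ and $\mathcal E\setminus S(\boldsymbol x)$ is bounded away from $\boldsymbol 0$ for all $\boldsymbol x\in\mathcal X'$. Let $r\ne0$, and suppose that one of the following holds. * **(Hom)** For $\boldsymbol x\in\mathcal X$ and $t>1$: $t^r\boldsymbol x\in\mathcal X$ and $\mathcal S(t^r\boldsymbol x)=t\,\mathcal S(\boldsymbol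 x)$; moreover $\mathcal S$ is continuous on $\mathcal X$ (in the sense of Painlevé–Kuratowski set convergence) and non-vacuous. * **(NonHom)** For $\boldsymbol x\in\mathcal X$ and $t>1$: $t^r\boldsymbol x\in\mathcal X$; and there are $\rho\ge0$ and $g^*:\mathbb R^m\times\mathbb R^d\to[-\infty,\infty]$ such that $\liminf_n n^{-\rho}g(n^r\boldsymbol x_n,n\boldsymbol z_n)\ge g^*(\boldsymbol x,\boldsymbol z)$ whenever $(\boldsymbol x_n,\boldsymbol z_n)\to(\boldsymbol x,\boldsymbol z)$; for all $\boldsymbol x_n\to\boldsymbol x$ and all $\boldsymbol z$ there is some $\boldsymbol z_n\to\boldsymbol z$ with $\limsup_n n^{-\rho}g(n^r\boldsymbol x_n,n\boldsymbol z_n)\le g^*(\boldsymbol x,\boldsymbol z)$; and $\mathcal S^*(\boldsymbol x)=\{\boldsymbol z\in\mathcal E:g^*(\boldsymbol x,\boldsymbol z)\le0\}$ is non-vacuous. We write **(NonHom$^+$)** for (NonHom) together with the following, for every $\boldsymbol x\in\mathcal X'$: the limsup bound holds for every $\boldsymbol x_n\to\boldsymbol x$ and every $\boldsymbol z_n\to\boldsymbol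 z$ in $\mathcal E$, and $\{\boldsymbol z\in\mathcal E:g^*(\boldsymbol x,\boldsymbol z)\ge0\}$ is bounded away from $\boldsymbol 0$. The cost $c:\mathcal X\to\mathbb R$ is lower semicontinuous, satisfies $c(t\boldsymbol x)=t\,c(\boldsymbol x)$ for $t>0$ and $c(\boldsymbol x)>0$ for $\boldsymbol x\neq\boldsymbol 0$, and $t\mapsto c(t^r\boldsymbol x)$ is strictly increasing on $(0,\infty)$ for every $\boldsymbol x\in\mathcal X'$. The probability measure $\mathbb P$ on $\mathbb R^d$ has a density $f$ vanishing off $\mathcal E$. We say that $(\mathscr L)$ holds with index $\gamma>0$ if there are $\varphi^*$, continuous and positive on $\mathcal E\setminus\{\boldsymbol 0\}$, and $\lambda:\mathbb R_+\to\mathbb R_+$, regularly varying with index $\gamma$, such that $-\log f(t\boldsymbol z)\sim\varphi^*(\boldsymbol z)\lambda(t)$ as $t\to\infty$, uniformly over $\boldsymbol z$ in compact subsets of $\mathcal E\setminus\{\boldsymbol 0\}$; and that $(\mathscr H)$ holds with index $\gamma>0$ if the same is true with $f(t\boldsymbol z)\sim\varphi^*(\boldsymbol z)t^{-d}\lambda(t)$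 and $\lambda$ regularly varying with index $-\gamma$. For $\alpha\in(0,1)$ let $v^*_\alpha=\inf\{c(\boldsymbol x):\boldsymbol x\in\mathcal X,\ \mathbb P\{\boldsymbol z: g_k(\boldsymbol x,\boldsymbol z)\le0\ \forall k\}\ge1-\alpha\}$. For $p\in[1,\infty)$ and $\eta\in(0,\infty)$ let $\mathcal P$ be the set of Borel probability measures $\mathbb Q$ on $\mathbb R^d$ with $d_W(\mathbb P,\mathbb Q)\le\eta$, where $d_W(\mathbb P,\mathbb Q)=\inf_\Pi (E_\Pi\|\boldsymbol X-\boldsymbol Y\|^p)^{1/p}$ over the couplings $\Pi$ of $\boldsymbol X\sim\mathbb P$ and $\boldsymbol Y\sim\mathbb Q$, and $\|\cdot\|$ is the Euclidean norm. **Theorem.** Suppose that $\mathbb P$ satisfies (i) $(\mathscr L)$ with some index $\gamma>0$, or (ii) $(\mathscr H)$ with some index $\gamma>p$, and that for every sufficiently small $\alpha>0$ the point $\boldsymbol x^{\tt W}_\alpha$ is an optimal solution of $$\min_{\boldsymbol x\in\mathcal X}c(\boldsymbol x)\quad\text{s.t.}\quad\inf_{\mathbb Q\in\mathcal P}\mathbb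 Q\{\boldsymbol z:g_k(\boldsymbol x,\boldsymbol z)\le0\ \forall k\}\ge1-\alpha .$$ Then for every $\varepsilon>0$ there is a constant $v>0$, not depending on $\alpha$, such that $$c(\boldsymbol x^{\tt W}_\alpha)\ \ge\ v\,\alpha^{-(r/p-\varepsilon)}\qquad\text{for all sufficiently small }\alpha>0 .$$ If moreover (Hom) or (NonHom$^+$) holds, then $v^*_\alpha>1$ for all sufficiently small $\alpha>0$, and $$\liminf_{\alpha\downarrow0}\frac{\log c(\boldsymbol x^{\tt W}_\alpha)}{\log v^*_\alpha}=\infty\ \text{ in case (i)},\qquad \liminf_{\alpha\downarrow0}\frac{\log c(\boldsymbol x^{\tt W}_\alpha)}{\log v^*_\alpha}\ge\frac{\gamma}{p}\ \text{ in case (ii)}.$$ -/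

import Mathlib

open Filter Topology MeasureTheory
open scoped ENNReal Pointwise

namespace CCP

/-- `ℝⁿ` with the Euclidean norm. -/
abbrev Vec (n : ℕ) : Type := EuclideanSpace ℝ (Fin n)

/-! ### Constraint functions, safe sets -/

section Constraints

variable {m d K : ℕ}

/-- The joint constraint function `max_k g_k(x, z)`. -/
noncomputable def maxConstraint (g : Fin K → Vec m → Vec d → EReal) (x : Vec m) (z : Vec d) :
    EReal :=
  ⨆ k, g k x z

/-- The safe set `S(x) = {z ∈ E : max_k g_k(x, z) ≤ 0}`. -/
def safeSet (E : Set (Vec d)) (g : Fin K → Vec m → Vec d → EReal) (x : Vec m) : Set (Vec d) :=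
  {z | z ∈ E ∧ maxConstraint g x z ≤ 0}

/-- `X' = {x ∈ X : int S(x) ≠ ∅}`. -/
def effectiveDecisions (E : Set (Vec d)) (X : Set (Vec m))
    (g : Fin K → Vec m → Vec d → EReal) : Set (Vec m) :=
  {x | x ∈ X ∧ (interior (safeSet E g x)).Nonempty}

/-- A set is bounded away from the origin. -/
def AwayFromZero (A : Set (Vec d)) : Prop := ∃ δ > 0, ∀ z ∈ A, δ ≤ ‖z‖

/-- A set-valued map `S` is non-vacuous for the support `E` and the decision set `X`: the unsafe
sets `E \ S(x)`, `x ∈ X`, are non-empty, and they are bounded away from `0` when `x ∈ X'`. -/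
def NonVacuous (E : Set (Vec d)) (X X' : Set (Vec m)) (S : Vec m → Set (Vec d)) : Prop :=
  (∀ x ∈ X, (E \ S x).Nonempty) ∧ ∀ x ∈ X', AwayFromZero (E \ S x)

/-- Continuity on `X` of a set-valued map, in the sense of Painlevé and Kuratowski: whenever
`xₙ → x` in `X`, the outer limit of `S(xₙ)` is contained in `S(x)`, and `S(x)` is contained in
the inner limit of `S(xₙ)`. -/
def SetContinuousOn (S : Vec m → Set (Vec d)) (X : Set (Vec m)) : Prop :=
  ∀ x ∈ X, ∀ u : ℕ → Vec m, (∀ n, u n ∈ X) → Tendsto u atTop (𝓝 x) →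
    (∀ (i : ℕ → ℕ) (w : ℕ → Vec d) (z : Vec d), StrictMono i → (∀ n, w n ∈ S (u (i n))) →
      Tendsto w atTop (𝓝 z) → z ∈ S x) ∧
    (∀ z ∈ S x, ∃ w : ℕ → Vec d, (∀ᶠ n in atTop, w n ∈ S (u n)) ∧ Tendsto w atTop (𝓝 z))

/-- The homogeneous safe-set model with scaling exponent `r`. -/
structure HomogeneousModel (E : Set (Vec d)) (X : Set (Vec m))
    (g : Fin K → Vec m → Vec d → EReal) (r : ℝ) : Prop where
  exponent_ne_zero : r ≠ 0
  scale_mem : ∀ x ∈ X, ∀ t : ℝ, 1 < t → t ^ r • x ∈ X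
  scale_safe : ∀ x ∈ X, ∀ t : ℝ, 1 < t → safeSet E g (t ^ r • x) = t • safeSet E g x
  continuous : SetContinuousOn (safeSet E g) X
  nonvacuous : NonVacuous E X (effectiveDecisions E X g) (safeSet E g)

/-- The rescaled constraint `max_k g_k(n^r x, n z) / n^ρ`. -/
noncomputable def rescaled (g : Fin K → Vec m → Vec d → EReal) (r ρ : ℝ) (n : ℕ)
    (x : Vec m) (z : Vec d) : EReal :=
  maxConstraint g ((n : ℝ) ^ r • x) ((n : ℝ) • z) / (((n : ℝ) ^ ρ : ℝ) : EReal)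

/-- The limiting safe set `S*(x) = {z ∈ E : g*(x, z) ≤ 0}`. -/
def limitSafeSet (E : Set (Vec d)) (gs : Vec m → Vec d → EReal) (x : Vec m) : Set (Vec d) :=
  {z | z ∈ E ∧ gs x z ≤ 0}

/-- The non-homogeneous safe-set model with scaling constants `r`, `ρ` and limit `g* = gs`. -/
structure NonHomogeneousModel (E : Set (Vec d)) (X : Set (Vec m))
    (g : Fin K → Vec m → Vec d → EReal) (r ρ : ℝ) (gs : Vec m → Vec d → EReal) : Prop where
  exponent_ne_zero : r ≠ 0
  rho_nonneg : 0 ≤ ρ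
  scale_mem : ∀ x ∈ X, ∀ t : ℝ, 1 < t → t ^ r • x ∈ X
  liminf_ge : ∀ (x : Vec m) (z : Vec d) (u : ℕ → Vec m) (w : ℕ → Vec d),
    Tendsto u atTop (𝓝 x) → Tendsto w atTop (𝓝 z) →
      gs x z ≤ liminf (fun n => rescaled g r ρ n (u n) (w n)) atTop
  limsup_le : ∀ (x : Vec m) (z : Vec d) (u : ℕ → Vec m), Tendsto u atTop (𝓝 x) →
    ∃ w : ℕ → Vec d, Tendsto w atTop (𝓝 z) ∧
      limsup (fun n => rescaled g r ρ n (u n) (w n)) atTop ≤ gs x z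
  nonvacuous : NonVacuous E X (effectiveDecisions E X g) (limitSafeSet E gs)

/-- Strengthened non-homogeneous model: at decisions `x ∈ X'` the upper bound on the rescaled
constraints holds along every sequence of scenarios in `E` (so that the rescaled constraints
converge continuously), and the larger set `{z ∈ E : g*(x, z) ≥ 0}` is bounded away from `0`. -/
structure StrongNonHomogeneousModel (E : Set (Vec d)) (X : Set (Vec m))
    (g : Fin K → Vec m → Vec d → EReal) (r ρ : ℝ) (gs : Vec m → Vec d → EReal) : Prop
    extends NonHomogeneousModel E X g r ρ gs where
  limsup_le_all : ∀ x ∈ effectiveDecisions E X g, ∀ z ∈ E, ∀ (u : ℕ → Vec m) (w : ℕ → Vec d),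
    (∀ n, w n ∈ E) → Tendsto u atTop (𝓝 x) → Tendsto w atTop (𝓝 z) →
      limsup (fun n => rescaled g r ρ n (u n) (w n)) atTop ≤ gs x z
  away_of_nonneg : ∀ x ∈ effectiveDecisions E X g, AwayFromZero {z | z ∈ E ∧ 0 ≤ gs x z}

/-! ### Cost function -/

/-- The cost function is positively homogeneous on the cone `X`, and `t ↦ c(t^r x)` is strictly
increasing on `t > 0` for every `x ∈ X'`. -/
structure CostModel (E : Set (Vec d)) (X : Set (Vec m))
    (g : Fin K → Vec m → Vec d → EReal) (r : ℝ) (c : Vec m → ℝ) : Prop where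
  cone : ∀ x ∈ X, ∀ t : ℝ, 0 < t → t • x ∈ X
  homogeneous : ∀ x ∈ X, ∀ t : ℝ, 0 < t → c (t • x) = t * c x
  strictMono : ∀ x ∈ effectiveDecisions E X g,
    StrictMonoOn (fun t : ℝ => c (t ^ r • x)) (Set.Ioi 0)

/-! ### Chance-constrained problems -/

/-- The event that all constraints are satisfied. -/
def satisfied (g : Fin K → Vec m → Vec d → EReal) (x : Vec m) : Set (Vec d) :=
  {z | ∀ k, g k x z ≤ 0}

/-- Feasible decisions of the chance-constrained problem under `P`. -/
def ccpFeasible (X : Set (Vec m)) (g : Fin K → Vec m → Vec d → EReal) (P : Measure (Vec d))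
    (α : ℝ) : Set (Vec m) :=
  {x | x ∈ X ∧ ENNReal.ofReal (1 - α) ≤ P (satisfied g x)}

/-- Optimal value of the chance-constrained problem under `P`. -/
noncomputable def ccpValue (X : Set (Vec m)) (g : Fin K → Vec m → Vec d → EReal)
    (c : Vec m → ℝ) (P : Measure (Vec d)) (α : ℝ) : ℝ :=
  sInf (c '' ccpFeasible X g P α)

/-- Feasible decisions of the distributionally robust problem with ambiguity set `Amb`. -/
def droFeasible (X : Set (Vec m)) (g : Fin K → Vec m → Vec d → EReal)
    (Amb : Set (Measure (Vec d))) (α : ℝ) : Set (Vec m) :=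
  {x | x ∈ X ∧ ENNReal.ofReal (1 - α) ≤ ⨅ Q ∈ Amb, Q (satisfied g x)}

/-- `x` is an optimal solution of the distributionally robust problem. -/
def IsDroOptimal (X : Set (Vec m)) (g : Fin K → Vec m → Vec d → EReal) (c : Vec m → ℝ)
    (Amb : Set (Measure (Vec d))) (α : ℝ) (x : Vec m) : Prop :=
  x ∈ droFeasible X g Amb α ∧ ∀ y ∈ droFeasible X g Amb α, c x ≤ c y

end Constraints

/-! ### Wasserstein balls -/

section Wasserstein

variable {d : ℕ}

/-- Joint distributions with marginals `P₁` and `P₂`. -/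
def couplings (P₁ P₂ : Measure (Vec d)) : Set (Measure (Vec d × Vec d)) :=
  {π | π.map Prod.fst = P₁ ∧ π.map Prod.snd = P₂}

/-- Wasserstein distance of order `p`. -/
noncomputable def wassersteinDist (p : ℝ) (P₁ P₂ : Measure (Vec d)) : ℝ≥0∞ :=
  ⨅ π ∈ couplings P₁ P₂, (∫⁻ w, edist w.1 w.2 ^ p ∂π) ^ (1 / p)

/-- The Wasserstein ball of radius `η` around `P`. -/
def wassersteinBall (p η : ℝ) (P : Measure (Vec d)) : Set (Measure (Vec d)) :=
  {Q | IsProbabilityMeasure Q ∧ wassersteinDist p P Q ≤ ENNReal.ofReal η}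

end Wasserstein

/-! ### Distributional assumptions -/

section Tails

variable {d : ℕ}

/-- `E` is a closed cone which is the closure of its interior. -/
structure IsSupportCone (E : Set (Vec d)) : Prop where
  isClosed : IsClosed E
  cone : ∀ z ∈ E, ∀ t : ℝ, 0 < t → t • z ∈ E
  closure_interior : closure (interior E) = E

/-- `P` has the probability density `f`, which vanishes off `E`. -/
structure HasDensityOn (P : Measure (Vec d)) (f : Vec d → ℝ) (E : Set (Vec d)) : Prop where
  measurable : Measurable f
  nonneg : ∀ z, 0 ≤ f z
  zero_off : ∀ z, z ∉ E → f z = 0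
  eq_withDensity : P = volume.withDensity fun z => ENNReal.ofReal (f z)

/-- `l : ℝ₊ → ℝ₊` is regularly varying with index `ρ`. -/
def RegularlyVarying (l : ℝ → ℝ) (ρ : ℝ) : Prop :=
  (∀ t, 0 ≤ t → 0 ≤ l t) ∧
    ∀ x : ℝ, 0 < x → Tendsto (fun t => l (t * x) / l t) atTop (𝓝 (x ^ ρ))

/-- `a(t, z) ∼ b(t, z)` as `t → ∞`, uniformly over `z` in compact subsets of `E` not containing
the origin. -/
def UniformlyAsymptotic (E : Set (Vec d)) (a b : ℝ → Vec d → ℝ) : Prop :=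
  ∀ C : Set (Vec d), IsCompact C → C ⊆ E → (0 : Vec d) ∉ C →
    TendstoUniformlyOn (fun t z => a t z / b t z) (fun _ => 1) atTop C

/-- Light-tailed densities of index `γ`: `-log f(tz) ∼ φ*(z) l(t)`, `l` regularly varying with
index `γ > 0`. -/
def LightTailed (E : Set (Vec d)) (f : Vec d → ℝ) (γ : ℝ) : Prop :=
  0 < γ ∧ ∃ (φ : Vec d → ℝ) (l : ℝ → ℝ),
    (∀ z ∈ E, z ≠ 0 → 0 < φ z) ∧ ContinuousOn φ (E \ {0}) ∧ RegularlyVarying l γ ∧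
    UniformlyAsymptotic E (fun t z => -Real.log (f (t • z))) (fun t z => φ z * l t)

/-- Heavy-tailed densities of index `γ`: `f(tz) ∼ φ*(z) t^{-d} l(t)`, `l` regularly varying with
index `-γ < 0`. -/
def HeavyTailed (E : Set (Vec d)) (f : Vec d → ℝ) (γ : ℝ) : Prop :=
  0 < γ ∧ ∃ (φ : Vec d → ℝ) (l : ℝ → ℝ),
    (∀ z ∈ E, z ≠ 0 → 0 < φ z) ∧ ContinuousOn φ (E \ {0}) ∧ RegularlyVarying l (-γ) ∧
    UniformlyAsymptotic E (fun t z => f (t • z)) (fun t z => φ z * t ^ (-(d : ℝ)) * l t)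

end Tails

end CCP

/-!
Write `R ≈ α ^ (-1 / p)`. An adversary who may spend Wasserstein cost `η` can transport slightly
more than the mass `α` to any point at distance at most a constant multiple of `R`, so the unsafe
scenarios of a robustly feasible decision all lie at distance at least of order `R` from the origin
(`exists_unsafe_far_of_droFeasible`). In particular its safe set has interior points, which makes it
an effective decision; monotonicity of the cost along its ray then gives `r > 0`. On the
other hand, the limiting safe set at the decision `0` omits some direction `z₀`, and therefore
`n • z₀` is unsafe for every decision that is small compared with `n ^ r`
(`exists_unsafe_direction`). With `n ≈ R` this gives `‖x‖ ≳ R ^ r`, and the cost dominates the norm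
(`exists_mul_norm_le_cost`); hence the robust cost is at least of order `α ^ (-r / p)`
(`exists_robust_cost_lower_bound`).

For the nominal problem, fix an effective decision `x`. The unsafe scenarios of `n ^ r • x` lie
outside a ball of radius of order `n` (`exists_safe_radius`), so if `P` has a polynomial tail of
order `q`, then `n ≈ α ^ (-1 / q)` is large enough for feasibility and the nominal value is at most
of order `α ^ (-r / q)` (`exists_ccpValue_upper_bound`). A light tail is polynomial of every order
`q` and a heavy tail of index `γ` is so for every `q < γ`; both follow by iterating regular
variation along the powers of two, which needs no measurability or local uniformity of the regularly
varying function. Since the density is positive far out, the unsafe set of decisions of bounded cost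
has probability bounded below, so the nominal value exceeds `1` for small `α`
(`eventually_lt_cost_of_ccpFeasible`). Comparing logarithms, the ratio is eventually at least `β`
whenever `β p < q`, and `q` may be taken arbitrarily large, or arbitrarily close to `γ`.
-/

namespace CCP

/-! ### Sequential conditions and their filter forms -/

/-- A convergent sequence prescribed along a subsequence of indices extends to a convergent
sequence, the missing terms being filled with the limit. -/
lemma exists_extend_tendsto {Y : Type*} [TopologicalSpace Y] {φ : ℕ → ℕ} (hφ : StrictMono φ)
    {v : ℕ → Y} {x : Y} (hv : Tendsto v atTop (𝓝 x)) :
    ∃ u : ℕ → Y, Tendsto u atTop (𝓝 x) ∧ ∀ k, u (φ k) = v k := by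
  refine ⟨Function.extend φ v fun _ => x, ?_, fun k => hφ.injective.extend_apply _ _ _⟩
  intro s hs
  obtain ⟨K, hK⟩ := eventually_atTop.1 (hv hs)
  refine mem_atTop_sets.2 ⟨φ K, fun n hn => ?_⟩
  by_cases h : ∃ k, φ k = n
  · obtain ⟨k, rfl⟩ := h
    change Function.extend φ v (fun _ => x) (φ k) ∈ s
    rw [hφ.injective.extend_apply]
    exact hK k (hφ.le_iff_le.1 hn)
  · change Function.extend φ v (fun _ => x) n ∈ s
    rw [Function.extend_apply' _ _ _ h]
    exact mem_of_mem_nhds hs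

/-- A property that holds eventually along every sequence converging to `x` holds jointly for
large indices and points near `x`. -/
lemma eventually_prod_of_forall_seq {Y : Type*} [TopologicalSpace Y] [FirstCountableTopology Y]
    {p : ℕ → Y → Prop} {x : Y}
    (h : ∀ u : ℕ → Y, Tendsto u atTop (𝓝 x) → ∀ᶠ n in atTop, p n (u n)) :
    ∀ᶠ q in (atTop : Filter ℕ) ×ˢ 𝓝 x, p q.1 q.2 := by
  by_contra hcon
  obtain ⟨ns, hns, hbad⟩ := exists_seq_forall_of_frequently (not_eventually.1 hcon)
  obtain ⟨ψ, hψ, hφ⟩ := strictMono_subseq_of_tendsto_atTop hns.fst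
  obtain ⟨u, hu, huφ⟩ := exists_extend_tendsto hφ (hns.snd.comp hψ.tendsto_atTop)
  obtain ⟨n, hn⟩ := (hφ.tendsto_atTop.eventually (h u hu)).exists
  rw [huφ] at hn
  exact hbad _ hn

/-! ### Geometry of the safe sets -/

section Geometry

variable {m d K : ℕ}

lemma mem_satisfied_iff {g : Fin K → Vec m → Vec d → EReal} {x : Vec m} {z : Vec d} :
    z ∈ satisfied g x ↔ maxConstraint g x z ≤ 0 := by
  simp [satisfied, maxConstraint, iSup_le_iff]

lemma notMem_satisfied_of_rescaled_pos {g : Fin K → Vec m → Vec d → EReal} {r ρ : ℝ} {n : ℕ}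
    {x : Vec m} {z : Vec d} (h : 0 < rescaled g r ρ n x z) :
    (n : ℝ) • z ∉ satisfied g ((n : ℝ) ^ r • x) := by
  rw [mem_satisfied_iff]
  intro hle
  exact h.not_ge (EReal.div_nonpos_of_nonpos_of_nonneg hle
    (EReal.coe_nonneg.2 (Real.rpow_nonneg (Nat.cast_nonneg n) ρ)))

lemma mem_satisfied_of_rescaled_neg {g : Fin K → Vec m → Vec d → EReal} {r ρ : ℝ} {n : ℕ}
    (hn : 0 < n) {x : Vec m} {z : Vec d} (h : rescaled g r ρ n x z < 0) :
    (n : ℝ) • z ∈ satisfied g ((n : ℝ) ^ r • x) := by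
  rw [mem_satisfied_iff]
  by_contra hpos
  refine h.not_gt (EReal.div_pos (not_le.1 hpos) ?_ (EReal.coe_ne_top _))
  exact EReal.coe_pos.2 (Real.rpow_pos_of_pos (Nat.cast_pos.2 hn) ρ)

lemma zero_mem_of_cone {X : Set (Vec m)} (hX : IsClosed X) (hne : X.Nonempty)
    (hcone : ∀ x ∈ X, ∀ t : ℝ, 0 < t → t • x ∈ X) : (0 : Vec m) ∈ X := by
  obtain ⟨x, hx⟩ := hne
  have h : Tendsto (fun t : ℝ => t • x) (𝓝[>] 0) (𝓝 ((0 : ℝ) • x)) :=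
    ((continuous_id.smul continuous_const).tendsto _).mono_left nhdsWithin_le_nhds
  rw [zero_smul] at h
  exact hX.mem_of_tendsto h (eventually_mem_nhdsWithin.mono fun t ht => hcone x hx t ht)

/-- Some scenario direction is unsafe, at all large scales `n`, for all decisions that are small
compared with `n ^ r`: the complement of the limiting safe set at the decision `0` is non-empty,
and it is approached uniformly. -/
lemma exists_unsafe_direction {E : Set (Vec d)} (hE : IsSupportCone E) {X : Set (Vec m)}
    {g : Fin K → Vec m → Vec d → EReal} {r : ℝ} (h0 : (0 : Vec m) ∈ X)
    (hmodel : HomogeneousModel E X g r ∨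
      ∃ (ρ : ℝ) (gs : Vec m → Vec d → EReal), NonHomogeneousModel E X g r ρ gs) :
    ∃ z₀ ∈ E, ∃ δ > 0, ∃ N : ℕ, ∀ n ≥ N, ∀ y ∈ X, ‖y‖ < δ → ∀ w ∈ E, dist w z₀ < δ →
      (n : ℝ) • w ∉ satisfied g ((n : ℝ) ^ r • y) := by
  suffices h : ∃ z₀ ∈ E, ∀ᶠ q : ℕ × (Vec m × Vec d) in atTop ×ˢ 𝓝 (0, z₀),
      q.2.1 ∈ X → q.2.2 ∈ E → (q.1 : ℝ) • q.2.2 ∉ satisfied g ((q.1 : ℝ) ^ r • q.2.1) by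
    obtain ⟨z₀, hz₀, hev⟩ := h
    obtain ⟨pa, ha, pb, hb, hab⟩ := eventually_prod_iff.1 hev
    obtain ⟨N, hN⟩ := eventually_atTop.1 ha
    obtain ⟨δ, hδ, hball⟩ := Metric.eventually_nhds_iff.1 hb
    refine ⟨z₀, hz₀, δ, hδ, N, fun n hn y hy hyδ w hw hwδ => ?_⟩
    refine hab (hN n hn) (hball (y := (y, w)) ?_) hy hw
    rw [Prod.dist_eq, max_lt_iff]
    exact ⟨by simpa using hyδ, hwδ⟩
  rcases hmodel with hm | ⟨ρ, gs, hm⟩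
  · obtain ⟨z₀, hz₀E, hz₀⟩ := hm.nonvacuous.1 0 h0
    refine ⟨z₀, hz₀E, ?_⟩
    have hfar : ∀ᶠ q : Vec m × Vec d in 𝓝 (0, z₀), q.1 ∈ X → q.2 ∉ safeSet E g q.1 := by
      by_contra hcon
      obtain ⟨s, hs, hbad⟩ := exists_seq_forall_of_frequently (not_eventually.1 hcon)
      rw [nhds_prod_eq] at hs
      simp only [Classical.not_imp, not_not] at hbad
      exact hz₀ ((hm.continuous 0 h0 _ (fun n => (hbad n).1) hs.fst).1 id _ _ strictMono_id
        (fun n => (hbad n).2) hs.snd)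
    have hprod := (eventually_gt_atTop 1).prod_mk hfar
    filter_upwards [hprod] with q ⟨hq1, hq⟩ hqX hqE hsat
    have hn : (1 : ℝ) < q.1 := by exact_mod_cast hq1
    have hmem : (q.1 : ℝ) • q.2.2 ∈ safeSet E g ((q.1 : ℝ) ^ r • q.2.1) :=
      ⟨hE.cone _ hqE _ (by linarith), mem_satisfied_iff.1 hsat⟩
    rw [hm.scale_safe _ hqX _ hn, Set.smul_mem_smul_set_iff₀ (by linarith)] at hmem
    exact hq hqX hmem
  · obtain ⟨z₀, hz₀E, hz₀⟩ := hm.nonvacuous.1 0 h0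
    refine ⟨z₀, hz₀E, ?_⟩
    have hpos : 0 < gs 0 z₀ := not_le.1 fun h => hz₀ ⟨hz₀E, h⟩
    have := eventually_prod_of_forall_seq (x := ((0 : Vec m), z₀))
      (p := fun n q => 0 < rescaled g r ρ n q.1 q.2) fun u hu => by
        rw [nhds_prod_eq] at hu
        exact eventually_lt_of_lt_liminf (hpos.trans_le (hm.liminf_ge 0 z₀ _ _ hu.fst hu.snd))
    exact this.mono fun q hq _ _ => notMem_satisfied_of_rescaled_pos hq

/-- Along the ray of an effective decision the unsafe scenarios move away from the origin at
linear speed. -/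
lemma exists_safe_radius {E : Set (Vec d)} (hE : IsSupportCone E) {X : Set (Vec m)}
    {g : Fin K → Vec m → Vec d → EReal} {r : ℝ}
    (hmodel : HomogeneousModel E X g r ∨
      ∃ (ρ : ℝ) (gs : Vec m → Vec d → EReal), StrongNonHomogeneousModel E X g r ρ gs)
    {x : Vec m} (hx : x ∈ effectiveDecisions E X g) :
    ∃ δ > 0, ∃ N : ℕ, ∀ n ≥ N, ∀ z ∈ E, ‖z‖ < δ * n → z ∈ satisfied g ((n : ℝ) ^ r • x) := by
  suffices h : ∃ δ > 0, ∃ N : ℕ, ∀ n ≥ N, ∀ w ∈ E, ‖w‖ < δ →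
      (n : ℝ) • w ∈ satisfied g ((n : ℝ) ^ r • x) by
    obtain ⟨δ, hδ, N, hN⟩ := h
    refine ⟨δ, hδ, max N 1, fun n hn z hz hzn => ?_⟩
    have hn0 : (0 : ℝ) < n := by exact_mod_cast (le_max_right N 1).trans hn
    have := hN n ((le_max_left N 1).trans hn) ((n : ℝ)⁻¹ • z) (hE.cone z hz _ (inv_pos.2 hn0)) (by
      rw [norm_smul, norm_inv, Real.norm_of_nonneg hn0.le, inv_mul_lt_iff₀ hn0]
      linarith)
    rwa [smul_inv_smul₀ hn0.ne'] at this
  rcases hmodel with hm | ⟨ρ, gs, hm⟩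
  · obtain ⟨δ, hδ, hfar⟩ := hm.nonvacuous.2 x hx
    refine ⟨δ, hδ, 2, fun n hn w hw hwδ => ?_⟩
    have hn1 : (1 : ℝ) < n := by exact_mod_cast hn
    have hws : w ∈ safeSet E g x := by
      by_contra hws
      exact hwδ.not_ge (hfar w ⟨hw, hws⟩)
    have := Set.smul_mem_smul_set (a := (n : ℝ)) hws
    rw [← hm.scale_safe x hx.1 _ hn1] at this
    exact mem_satisfied_iff.2 this.2
  · obtain ⟨δ, hδ, hfar⟩ := hm.away_of_nonneg x hx
    refine ⟨δ / 2, half_pos hδ, ?_⟩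
    have hK : IsCompact (E ∩ Metric.closedBall 0 (δ / 2)) :=
      (isCompact_closedBall _ _).inter_left hE.isClosed
    have key : ∀ w ∈ E ∩ Metric.closedBall 0 (δ / 2),
        {q : ℕ × Vec d | q.2 ∈ E → rescaled g r ρ q.1 x q.2 < 0} ∈ atTop ×ˢ 𝓝 w := by
      rintro w ⟨hwE, hwδ⟩
      have hneg : gs x w < 0 := by
        by_contra hge
        have h1 := hfar w ⟨hwE, not_lt.1 hge⟩
        have h2 : ‖w‖ ≤ δ / 2 := by simpa using hwδ
        linarith
      refine eventually_prod_of_forall_seq (p := fun n q => q ∈ E → rescaled g r ρ n x q < 0)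
        fun u hu => ?_
      classical
      -- terms outside `E` are replaced by the limit, which lies in `E`
      have hu' : Tendsto (fun n => if u n ∈ E then u n else w) atTop (𝓝 w) := by
        refine tendsto_def.2 fun s hs => ?_
        filter_upwards [tendsto_def.1 hu s hs] with n hn
        by_cases h : u n ∈ E
        · simpa [h] using hn
        · simpa [h] using mem_of_mem_nhds hs
      have hlim := hm.limsup_le_all x hx w hwE (fun _ => x) _
        (fun n => by by_cases h : u n ∈ E <;> simp [h, hwE]) tendsto_const_nhds hu'
      filter_upwards [eventually_lt_of_limsup_lt (hlim.trans_lt hneg)] with n hn hE'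
      simpa [hE'] using hn
    obtain ⟨pa, ha, pb, hb, hab⟩ := eventually_prod_iff.1 (hK.mem_prod_nhdsSet_of_forall key)
    obtain ⟨N, hN⟩ := eventually_atTop.1 ha
    refine ⟨max N 1, fun n hn w hw hwδ => ?_⟩
    refine mem_satisfied_of_rescaled_neg ((le_max_right N 1).trans hn) (ρ := ρ) ?_
    exact hab (hN n ((le_max_left N 1).trans hn))
      (subset_of_mem_nhdsSet hb ⟨hw, by simpa using hwδ.le⟩) hw

/-! ### The cost function -/

/-- A positive, positively homogeneous, lower semicontinuous cost dominates the norm. -/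
lemma exists_mul_norm_le_cost {X : Set (Vec m)} (hX : IsClosed X) {c : Vec m → ℝ}
    (hcone : ∀ x ∈ X, ∀ t : ℝ, 0 < t → t • x ∈ X)
    (hhom : ∀ x ∈ X, ∀ t : ℝ, 0 < t → c (t • x) = t * c x)
    (hlsc : LowerSemicontinuousOn c X) (hpos : ∀ x ∈ X, x ≠ 0 → 0 < c x) :
    ∃ κ > 0, ∀ x ∈ X, κ * ‖x‖ ≤ c x := by
  have hzero : ∀ x ∈ X, x = 0 → c x = 0 := by
    rintro x hx rfl
    have := hhom 0 hx 2 two_pos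
    rw [smul_zero] at this
    linarith
  have hnormal : ∀ x ∈ X, x ≠ 0 → ‖x‖⁻¹ • x ∈ X ∩ Metric.sphere 0 1 := fun x hx hx0 =>
    ⟨hcone x hx _ (inv_pos.2 (norm_pos_iff.2 hx0)), by
      simp [norm_smul, inv_mul_cancel₀ (norm_ne_zero_iff.2 hx0)]⟩
  rcases (X ∩ Metric.sphere 0 1).eq_empty_or_nonempty with hemp | hne
  · refine ⟨1, one_pos, fun x hx => ?_⟩
    have hx0 : x = 0 := by
      by_contra hx0
      exact Set.notMem_empty _ (hemp ▸ hnormal x hx hx0)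
    rw [hzero x hx hx0, hx0]; simp
  · obtain ⟨a, ⟨haX, ha1⟩, hmin⟩ := (hlsc.mono Set.inter_subset_left).exists_isMinOn hne
      ((isCompact_sphere _ _).inter_left hX)
    have ha0 : a ≠ 0 := by
      rintro rfl
      simp at ha1
    refine ⟨c a, hpos a haX ha0, fun x hx => ?_⟩
    rcases eq_or_ne x 0 with hx0 | hx0
    · rw [hzero x hx hx0, hx0]; simp
    · have h := isMinOn_iff.1 hmin _ (hnormal x hx hx0)
      have hn : 0 < ‖x‖ := norm_pos_iff.2 hx0
      rw [hhom x hx _ (inv_pos.2 hn), inv_mul_eq_div, le_div_iff₀ hn] at h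
      exact h

/-- The monotonicity of the cost along rays forces the scaling exponent to be positive. -/
lemma exponent_pos_of_effective {E : Set (Vec d)} {X : Set (Vec m)}
    {g : Fin K → Vec m → Vec d → EReal} {r : ℝ} {c : Vec m → ℝ} (hc : CostModel E X g r c)
    (hpos : ∀ x ∈ X, x ≠ 0 → 0 < c x) {x : Vec m} (hx : x ∈ effectiveDecisions E X g) :
    0 < r ∧ 0 < c x := by
  have h12 := hc.strictMono x hx (Set.mem_Ioi.2 one_pos) (Set.mem_Ioi.2 two_pos) one_lt_two
  simp only [Real.one_rpow, one_smul] at h12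
  rw [hc.homogeneous x hx.1 _ (Real.rpow_pos_of_pos two_pos r)] at h12
  have hx0 : x ≠ 0 := by
    rintro rfl
    have := hc.homogeneous 0 hx.1 2 two_pos
    rw [smul_zero] at this
    have h0 : c 0 = 0 := by linarith
    simp [h0] at h12
  have hcx := hpos x hx.1 hx0
  refine ⟨?_, hcx⟩
  by_contra hr
  have := Real.rpow_le_one_of_one_le_of_nonpos (one_le_two (α := ℝ)) (not_lt.1 hr)
  nlinarith

end Geometry

/-! ### Moving mass inside a Wasserstein ball -/

section Transport

variable {m d K : ℕ}

lemma wassersteinDist_self {p : ℝ} (hp : 0 < p) (P : Measure (Vec d)) :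
    wassersteinDist p P P = 0 := by
  have hdiag : Measurable fun y : Vec d => (y, y) := by fun_prop
  have hcoup : P.map (fun y => (y, y)) ∈ couplings P P := by
    constructor
    · rw [Measure.map_map measurable_fst hdiag]; exact Measure.map_id
    · rw [Measure.map_map measurable_snd hdiag]; exact Measure.map_id
  refine le_antisymm ((iInf₂_le _ hcoup).trans ?_) bot_le
  rw [lintegral_map (by fun_prop) hdiag]
  simp [hp]

lemma droFeasible_subset_ccpFeasible {X : Set (Vec m)} {g : Fin K → Vec m → Vec d → EReal}
    {P : Measure (Vec d)} [IsProbabilityMeasure P] {p η α : ℝ} (hp : 0 < p) :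
    droFeasible X g (wassersteinBall p η P) α ⊆ ccpFeasible X g P α := fun _ hx =>
  ⟨hx.1, hx.2.trans (iInf₂_le P ⟨inferInstance, by rw [wassersteinDist_self hp]; exact bot_le⟩)⟩

/-- If half of the mass of `P` lies in the ball of radius `M`, then the ambiguity set contains a
distribution with mass `2 α` at any point `z` with `4 α (M + ‖z‖) ^ p ≤ η ^ p`: transport the
fraction `4 α` of the mass in that ball to `z`. -/
lemma exists_mem_wassersteinBall_atom {P : Measure (Vec d)} [IsProbabilityMeasure P] {p η : ℝ}
    (hp : 0 < p) (hη : 0 ≤ η) {M : ℝ} (hM : 2⁻¹ ≤ P (Metric.closedBall 0 M)) {α : ℝ}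
    (hα : 0 ≤ α) (hα4 : 4 * α ≤ 1) {z : Vec d} (hz : 4 * α * (M + ‖z‖) ^ p ≤ η ^ p) :
    ∃ Q ∈ wassersteinBall p η P, ENNReal.ofReal (2 * α) ≤ Q {z} := by
  classical
  have hM0 : 0 ≤ M := by
    by_contra hneg
    rw [Metric.closedBall_eq_empty.2 (not_le.1 hneg)] at hM
    simp at hM
  set T : Vec d → Vec d := fun y => if y ∈ Metric.closedBall 0 M then z else y with hT
  have hTm : Measurable T :=
    Measurable.ite Metric.isClosed_closedBall.measurableSet measurable_const measurable_id
  have hdiag : Measurable fun y : Vec d => (y, y) := by fun_prop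
  have hgraph : Measurable fun y : Vec d => (y, T y) := by fun_prop
  set a := ENNReal.ofReal (1 - 4 * α)
  set b := ENNReal.ofReal (4 * α)
  have hab : a + b = 1 := by
    rw [← ENNReal.ofReal_add (by linarith) (by linarith)]; simp
  set Q := a • P + b • P.map T
  set π := a • P.map (fun y => (y, y)) + b • P.map fun y => (y, T y)
  have hcoup : π ∈ couplings P Q := by
    constructor
    · rw [Measure.map_add _ _ measurable_fst, Measure.map_smul, Measure.map_smul,
        Measure.map_map measurable_fst hdiag, Measure.map_map measurable_fst hgraph]
      change a • P.map id + b • P.map id = P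
      rw [Measure.map_id, ← add_smul, hab, one_smul]
    · rw [Measure.map_add _ _ measurable_snd, Measure.map_smul, Measure.map_smul,
        Measure.map_map measurable_snd hdiag, Measure.map_map measurable_snd hgraph]
      change a • P.map id + b • P.map T = Q
      rw [Measure.map_id]
  have hcost : ∀ y, edist y (T y) ^ p ≤ ENNReal.ofReal ((M + ‖z‖) ^ p) := by
    intro y
    rw [← ENNReal.ofReal_rpow_of_nonneg (by positivity) hp.le]
    refine ENNReal.rpow_le_rpow ?_ hp.le
    rw [edist_dist]
    refine ENNReal.ofReal_le_ofReal ?_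
    by_cases hy : y ∈ Metric.closedBall 0 M
    · simp only [hT, if_pos hy]
      have : ‖y‖ ≤ M := by simpa using hy
      rw [dist_eq_norm]
      exact (norm_sub_le _ _).trans (by linarith)
    · simp only [hT, if_neg hy, dist_self]
      positivity
  have htot : ∫⁻ w, edist w.1 w.2 ^ p ∂π ≤ ENNReal.ofReal (η ^ p) := by
    rw [lintegral_add_measure, lintegral_smul_measure, lintegral_smul_measure,
      lintegral_map (by fun_prop) hdiag, lintegral_map (by fun_prop) hgraph]
    simp only [edist_self, ENNReal.zero_rpow_of_pos hp, lintegral_zero, smul_zero, zero_add]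
    calc b • ∫⁻ y, edist y (T y) ^ p ∂P ≤ b • ∫⁻ _, ENNReal.ofReal ((M + ‖z‖) ^ p) ∂P := by
          gcongr with y
          exact hcost y
      _ = ENNReal.ofReal (4 * α * (M + ‖z‖) ^ p) := by
          rw [lintegral_const, measure_univ, mul_one, smul_eq_mul,
            ← ENNReal.ofReal_mul (by linarith)]
      _ ≤ _ := ENNReal.ofReal_le_ofReal hz
  refine ⟨Q, ⟨⟨?_⟩, ?_⟩, ?_⟩
  · simp only [Q, Measure.coe_add, Measure.coe_smul, Pi.add_apply, Pi.smul_apply, measure_univ,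
      Measure.map_apply hTm MeasurableSet.univ, Set.preimage_univ, smul_eq_mul, mul_one, hab]
  · refine (iInf₂_le π hcoup).trans ?_
    refine (ENNReal.rpow_le_rpow htot (by positivity)).trans (le_of_eq ?_)
    rw [ENNReal.ofReal_rpow_of_nonneg (by positivity) (by positivity), ← Real.rpow_mul hη,
      mul_one_div_cancel hp.ne', Real.rpow_one]
  · have hsub : Metric.closedBall 0 M ⊆ T ⁻¹' {z} := fun y hy => if_pos hy
    calc ENNReal.ofReal (2 * α) = b * 2⁻¹ := by
          rw [show (2 : ℝ≥0∞)⁻¹ = ENNReal.ofReal 2⁻¹ by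
            rw [ENNReal.ofReal_inv_of_pos two_pos]; simp, ← ENNReal.ofReal_mul (by linarith)]
          congr 1; ring
      _ ≤ b * P (T ⁻¹' {z}) := by gcongr; exact hM.trans (measure_mono hsub)
      _ ≤ Q {z} := by
          simp only [Q, Measure.coe_add, Measure.coe_smul, Pi.add_apply, Pi.smul_apply,
            Measure.map_apply hTm (measurableSet_singleton z), smul_eq_mul]
          exact le_add_self

lemma exists_half_le_measure_closedBall (P : Measure (Vec d)) [IsProbabilityMeasure P] :
    ∃ M : ℝ, 2⁻¹ ≤ P (Metric.closedBall 0 M) := by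
  have hmono : Monotone fun n : ℕ => Metric.closedBall (0 : Vec d) n := fun a b hab =>
    Metric.closedBall_subset_closedBall (by exact_mod_cast hab)
  have h := tendsto_measure_iUnion_atTop (μ := P) hmono
  rw [Metric.iUnion_closedBall_nat, measure_univ] at h
  obtain ⟨n, hn⟩ := (h.eventually_const_lt (u := 2⁻¹) (by simp)).exists
  exact ⟨n, hn.le⟩

/-- Unsafe scenarios of robustly feasible decisions are at distance of order at least
`α ^ (-1 / p)` from the origin: a mass larger than `α` could be transported to a closer one. -/
lemma exists_unsafe_far_of_droFeasible {X : Set (Vec m)} {g : Fin K → Vec m → Vec d → EReal}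
    {P : Measure (Vec d)} [IsProbabilityMeasure P] {p η : ℝ} (hp : 0 < p) (hη : 0 < η) :
    ∃ κ > 0, ∀ᶠ α in 𝓝[>] (0 : ℝ), ∀ x ∈ droFeasible X g (wassersteinBall p η P) α,
      ∀ z, z ∉ satisfied g x → κ * α ^ (-(1 / p)) ≤ ‖z‖ := by
  obtain ⟨M, hM⟩ := exists_half_le_measure_closedBall P
  -- the radius at which transporting the mass `4 α` costs `η`, halved to absorb `M`
  set κ := η * (4 : ℝ) ^ (-(1 / p)) / 2 with hκdef
  have hκ : 0 < κ := by positivity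
  refine ⟨κ, hκ, ?_⟩
  have hinf : Tendsto (fun α : ℝ => κ * α ^ (-(1 / p))) (𝓝[>] 0) atTop :=
    (tendsto_rpow_neg_nhdsGT_zero (by simpa using hp)).const_mul_atTop hκ
  have hsmall : ∀ᶠ α in 𝓝[>] (0 : ℝ), α < 1 / 4 :=
    nhdsWithin_le_nhds (gt_mem_nhds (by norm_num))
  filter_upwards [hinf.eventually_ge_atTop M, hsmall, eventually_mem_nhdsWithin] with
    α hαM hα4 hα0 x hx z hz
  replace hα0 : 0 < α := hα0
  by_contra! hlt
  obtain ⟨Q, hQ, hatom⟩ := exists_mem_wassersteinBall_atom (z := z) hp hη.le hM hα0.le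
    (by linarith) (by
      have h1 : M + ‖z‖ ≤ 2 * (κ * α ^ (-(1 / p))) := by linarith
      have h0 : 0 ≤ M + ‖z‖ := by
        by_contra! hneg
        rw [Metric.closedBall_eq_empty.2 (by linarith [norm_nonneg z])] at hM
        simp at hM
      have h2 : (M + ‖z‖) ^ p ≤ (η * (4 * α) ^ (-(1 / p))) ^ p := by
        refine Real.rpow_le_rpow h0 (h1.trans (le_of_eq ?_)) hp.le
        rw [Real.mul_rpow (by norm_num) hα0.le, hκdef]
        ring
      rw [Real.mul_rpow hη.le (by positivity), ← Real.rpow_mul (by positivity),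
        neg_mul, one_div_mul_cancel hp.ne', Real.rpow_neg_one] at h2
      calc 4 * α * (M + ‖z‖) ^ p ≤ 4 * α * (η ^ p * (4 * α)⁻¹) := by gcongr
        _ = η ^ p := by field_simp)
  have : IsProbabilityMeasure Q := hQ.1
  have hfeas : ENNReal.ofReal (1 - α) ≤ Q (satisfied g x) := hx.2.trans (iInf₂_le Q hQ)
  have hdisj : Q (satisfied g x) + Q {z} ≤ 1 := by
    rw [← measure_union (by simpa using hz) (measurableSet_singleton z)]
    exact prob_le_one
  have hsum : ENNReal.ofReal (1 - α + 2 * α) ≤ 1 := by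
    rw [ENNReal.ofReal_add (by linarith) (by linarith)]
    exact (add_le_add hfeas hatom).trans hdisj
  rw [ENNReal.ofReal_le_one] at hsum
  linarith

end Transport

/-! ### Tails of the nominal distribution -/

section TailBounds

variable {d : ℕ}

/-- The tail `P {‖z‖ ≥ s}` is at most of order `s ^ (-q)`. -/
def HasPolynomialTail (P : Measure (Vec d)) (q : ℝ) : Prop :=
  ∃ C > 0, ∀ᶠ s in atTop, P {z | s ≤ ‖z‖} ≤ ENNReal.ofReal (C * s ^ (-q))

/-- The part of the cone `E` in the closed annulus with radii `1` and `2`. -/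
def coneAnnulus (E : Set (Vec d)) : Set (Vec d) := {z | z ∈ E ∧ 1 ≤ ‖z‖ ∧ ‖z‖ ≤ 2}

lemma isCompact_coneAnnulus {E : Set (Vec d)} (hE : IsClosed E) : IsCompact (coneAnnulus E) := by
  have h : coneAnnulus E = Metric.closedBall 0 2 ∩ (E ∩ {z | 1 ≤ ‖z‖}) := by
    ext z
    simp only [coneAnnulus, Set.mem_ofPred_eq, Set.mem_inter_iff, mem_closedBall_zero_iff]
    tauto
  rw [h]
  exact (isCompact_closedBall _ _).inter_right
    (hE.inter (isClosed_le continuous_const continuous_norm))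

lemma zero_notMem_coneAnnulus (E : Set (Vec d)) : (0 : Vec d) ∉ coneAnnulus E := by
  intro h
  have := h.2.1
  rw [norm_zero] at this
  linarith

lemma RegularlyVarying.eventually_pos {l : ℝ → ℝ} {ρ : ℝ} (hl : RegularlyVarying l ρ) :
    ∀ᶠ t in atTop, 0 < l t := by
  have h1 := hl.2 1 one_pos
  rw [Real.one_rpow] at h1
  filter_upwards [h1.eventually_ne one_ne_zero, eventually_ge_atTop 0] with t ht ht0
  refine lt_of_le_of_ne (hl.1 t ht0) fun h0 => ht ?_
  rw [← h0, div_zero]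

/-- The probability of an annulus is at most the supremum of the density times the volume of the
outer ball. -/
lemma measure_annulus_le {P : Measure (Vec d)} {f : Vec d → ℝ} {E : Set (Vec d)}
    (hE : IsSupportCone E) (hf : HasDensityOn P f E) {T b : ℝ} (hT : 0 < T) (hb : 0 ≤ b)
    (h : ∀ w ∈ coneAnnulus E, f (T • w) ≤ b) :
    P {z | T ≤ ‖z‖ ∧ ‖z‖ ≤ 2 * T} ≤
      ENNReal.ofReal (b * (2 * T) ^ d * (volume (Metric.ball (0 : Vec d) 1)).toReal) := by
  have hmeas : MeasurableSet {z : Vec d | T ≤ ‖z‖ ∧ ‖z‖ ≤ 2 * T} :=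
    ((isClosed_le continuous_const continuous_norm).inter
      (isClosed_le continuous_norm continuous_const)).measurableSet
  rw [hf.eq_withDensity, withDensity_apply _ hmeas]
  calc ∫⁻ z in {z | T ≤ ‖z‖ ∧ ‖z‖ ≤ 2 * T}, ENNReal.ofReal (f z)
      ≤ ∫⁻ _ in {z : Vec d | T ≤ ‖z‖ ∧ ‖z‖ ≤ 2 * T}, ENNReal.ofReal b := by
        refine setLIntegral_mono measurable_const fun z hz => ENNReal.ofReal_le_ofReal ?_
        by_cases hzE : z ∈ E
        · have hw : T⁻¹ • z ∈ coneAnnulus E := by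
            refine ⟨hE.cone z hzE _ (inv_pos.2 hT), ?_, ?_⟩ <;>
              rw [norm_smul, norm_inv, Real.norm_of_nonneg hT.le, inv_mul_eq_div]
            · rw [le_div_iff₀ hT, one_mul]; exact hz.1
            · rw [div_le_iff₀ hT]; exact hz.2
          have := h _ hw
          rwa [smul_inv_smul₀ hT.ne'] at this
        · rw [hf.zero_off z hzE]; exact hb
    _ ≤ ENNReal.ofReal b * volume (Metric.closedBall (0 : Vec d) (2 * T)) := by
        rw [setLIntegral_const]
        gcongr
        intro z hz
        simpa using hz.2
    _ = _ := by
        rw [Measure.addHaar_closedBall _ _ (by positivity), finrank_euclideanSpace_fin,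
          ← ENNReal.ofReal_toReal (measure_ball_lt_top (μ := volume) (x := (0 : Vec d))
            (r := 1)).ne, ← ENNReal.ofReal_mul (by positivity), ← ENNReal.ofReal_mul hb,
          ENNReal.toReal_ofReal ENNReal.toReal_nonneg]
        congr 1; ring

/-- Geometric decay over dyadic annuli gives a polynomial tail. -/
lemma hasPolynomialTail_of_dyadic {P : Measure (Vec d)} {q T C : ℝ} (hq : 0 < q) (hT : 0 < T)
    (hC : 0 < C)
    (h : ∀ k : ℕ, P {z | 2 ^ k * T ≤ ‖z‖ ∧ ‖z‖ ≤ 2 * (2 ^ k * T)} ≤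
      ENNReal.ofReal (C * ((2 : ℝ) ^ (-q)) ^ k)) :
    HasPolynomialTail P q := by
  set ρ : ℝ := (2 : ℝ) ^ (-q) with hρ
  have hρ0 : 0 < ρ := by positivity
  have hρ1 : ρ < 1 := Real.rpow_lt_one_of_one_lt_of_neg one_lt_two (neg_lt_zero.2 hq)
  have h1ρ : 0 < 1 - ρ := by linarith
  refine ⟨C * (1 - ρ)⁻¹ * (2 * T) ^ q, by positivity, ?_⟩
  filter_upwards [eventually_ge_atTop T] with s hs
  have hs0 : 0 < s := hT.trans_le hs
  obtain ⟨k, hk, hk'⟩ := exists_nat_pow_near ((one_le_div hT).2 hs) (one_lt_two (α := ℝ))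
  rw [le_div_iff₀ hT] at hk
  rw [div_lt_iff₀ hT] at hk'
  have hsub : {z : Vec d | s ≤ ‖z‖} ⊆
      ⋃ j : ℕ, {z | 2 ^ (k + j) * T ≤ ‖z‖ ∧ ‖z‖ ≤ 2 * (2 ^ (k + j) * T)} := by
    intro z hz
    have hz' : 2 ^ k * T ≤ ‖z‖ := hk.trans hz
    have hkT : 0 < 2 ^ k * T := by positivity
    obtain ⟨j, hj, hj'⟩ := exists_nat_pow_near ((one_le_div hkT).2 hz') (one_lt_two (α := ℝ))
    rw [le_div_iff₀ hkT] at hj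
    rw [div_lt_iff₀ hkT] at hj'
    refine Set.mem_iUnion.2 ⟨j, ?_, ?_⟩
    · calc (2 : ℝ) ^ (k + j) * T = 2 ^ j * (2 ^ k * T) := by ring
        _ ≤ _ := hj
    · calc ‖z‖ ≤ 2 ^ (j + 1) * (2 ^ k * T) := hj'.le
        _ = _ := by ring
  have hgeom : HasSum (fun j : ℕ => C * ρ ^ (k + j)) (C * ρ ^ k * (1 - ρ)⁻¹) := by
    simpa [pow_add, mul_assoc] using
      (hasSum_geometric_of_lt_one hρ0.le hρ1).mul_left (C * ρ ^ k)
  have hρk : ρ ^ k ≤ (2 * T) ^ q * s ^ (-q) := by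
    have h2k : s / (2 * T) ≤ 2 ^ k := by
      rw [div_le_iff₀ (by positivity)]
      calc s ≤ 2 ^ (k + 1) * T := hk'.le
        _ = _ := by ring
    calc ρ ^ k = ((2 : ℝ) ^ k) ^ (-q) := by
          rw [hρ, ← Real.rpow_natCast, ← Real.rpow_mul two_pos.le, mul_comm,
            Real.rpow_mul two_pos.le, Real.rpow_natCast]
      _ ≤ (s / (2 * T)) ^ (-q) :=
          Real.rpow_le_rpow_of_nonpos (by positivity) h2k (neg_nonpos.2 hq.le)
      _ = _ := by
          rw [Real.div_rpow hs0.le (by positivity), Real.rpow_neg (x := 2 * T) (by positivity)]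
          field_simp
  calc P {z | s ≤ ‖z‖} ≤ ∑' j : ℕ, ENNReal.ofReal (C * ρ ^ (k + j)) :=
        (measure_mono hsub).trans ((measure_iUnion_le _).trans
          (ENNReal.tsum_le_tsum fun j => h (k + j)))
    _ = ENNReal.ofReal (C * ρ ^ k * (1 - ρ)⁻¹) := by
        rw [← ENNReal.ofReal_tsum_of_nonneg (fun j => by positivity) hgeom.summable,
          hgeom.tsum_eq]
    _ ≤ _ := by
        refine ENNReal.ofReal_le_ofReal ?_
        calc C * ρ ^ k * (1 - ρ)⁻¹ = C * (1 - ρ)⁻¹ * ρ ^ k := by ring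
          _ ≤ C * (1 - ρ)⁻¹ * ((2 * T) ^ q * s ^ (-q)) := by gcongr
          _ = _ := by ring

/-- Iterating a one-step bound along the powers of two. -/
lemma pow_mul_le_of_step {l : ℝ → ℝ} {a T : ℝ} (ha : 0 ≤ a) (hT : 0 < T)
    (h : ∀ t ≥ T, l (t * 2) ≤ a * l t) (k : ℕ) : l (2 ^ k * T) ≤ a ^ k * l T := by
  induction k with
  | zero => simp
  | succ k ih =>
    have hTk : T ≤ 2 ^ k * T := le_mul_of_one_le_left hT.le (one_le_pow₀ one_le_two)
    calc l (2 ^ (k + 1) * T) = l (2 ^ k * T * 2) := by ring_nf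
      _ ≤ a * l (2 ^ k * T) := h _ hTk
      _ ≤ a * (a ^ k * l T) := by gcongr
      _ = _ := by ring

lemma le_pow_mul_of_step {l : ℝ → ℝ} {a T : ℝ} (ha : 0 ≤ a) (hT : 0 < T)
    (h : ∀ t ≥ T, a * l t ≤ l (t * 2)) (k : ℕ) : a ^ k * l T ≤ l (2 ^ k * T) := by
  have := pow_mul_le_of_step (l := fun t => -l t) ha hT (fun t ht => by linarith [h t ht]) k
  linarith

lemma HeavyTailed.hasPolynomialTail {P : Measure (Vec d)} {f : Vec d → ℝ} {E : Set (Vec d)}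
    (hE : IsSupportCone E) (hf : HasDensityOn P f E) {γ : ℝ} (h : HeavyTailed E f γ) {q : ℝ}
    (hq : 0 < q) (hqγ : q < γ) : HasPolynomialTail P q := by
  obtain ⟨-, φ, l, hφ, hφc, hl, hfl⟩ := h
  have hK := isCompact_coneAnnulus hE.isClosed
  have hK0 := zero_notMem_coneAnnulus E
  have hKE : coneAnnulus E ⊆ E := fun z hz => hz.1
  obtain ⟨Φ, hΦ⟩ := hK.bddAbove_image (hφc.mono fun z hz => ⟨hz.1, fun h => hK0 (h ▸ hz)⟩)
  have hbound : ∀ᶠ t in atTop, ∀ w ∈ coneAnnulus E,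
      f (t • w) ≤ 2 * (max Φ 1 * t ^ (-(d : ℝ)) * l t) := by
    filter_upwards [Metric.tendstoUniformlyOn_iff.1 (hfl _ hK hKE hK0) 1 one_pos,
      hl.eventually_pos, eventually_gt_atTop 0] with t ht hlt ht0 w hw
    have hw0 : w ≠ 0 := fun h => hK0 (h ▸ hw)
    have hden : 0 < φ w * t ^ (-(d : ℝ)) * l t := by
      have := hφ w hw.1 hw0
      positivity
    have h1 := ht w hw
    rw [Real.dist_eq, abs_lt] at h1
    have h2 : f (t • w) / (φ w * t ^ (-(d : ℝ)) * l t) ≤ 2 := by linarith [h1.1]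
    rw [div_le_iff₀ hden] at h2
    refine h2.trans ?_
    have : φ w ≤ max Φ 1 := (hΦ ⟨w, hw, rfl⟩).trans (le_max_left _ _)
    gcongr
  have hstep : ∀ᶠ t in atTop, l (t * 2) ≤ (2 : ℝ) ^ (-q) * l t := by
    have hlt : (2 : ℝ) ^ (-γ) < 2 ^ (-q) :=
      Real.rpow_lt_rpow_of_exponent_lt one_lt_two (neg_lt_neg hqγ)
    filter_upwards [(hl.2 2 two_pos).eventually_lt_const hlt, hl.eventually_pos] with t ht hlt
    exact ((div_lt_iff₀ hlt).1 ht).le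
  obtain ⟨T, hT⟩ := eventually_atTop.1 (hbound.and (hstep.and
    (hl.eventually_pos.and (eventually_gt_atTop 0))))
  have hT0 : 0 < T := (hT T le_rfl).2.2.2
  have hlT : 0 < l T := (hT T le_rfl).2.2.1
  set V := (volume (Metric.ball (0 : Vec d) 1)).toReal
  have hV : 0 ≤ V := ENNReal.toReal_nonneg
  refine hasPolynomialTail_of_dyadic hq hT0 (C := 2 * max Φ 1 * 2 ^ d * V * l T + 1)
    (by positivity) fun k => ?_
  have hTk : T ≤ 2 ^ k * T := le_mul_of_one_le_left hT0.le (one_le_pow₀ one_le_two)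
  set t := 2 ^ k * T with ht
  have ht0 : 0 < t := hT0.trans_le hTk
  have hlt : 0 < l t := (hT t hTk).2.2.1
  refine (measure_annulus_le hE hf ht0 (by positivity) (hT t hTk).1).trans
    (ENNReal.ofReal_le_ofReal ?_)
  have hlk : l t ≤ ((2 : ℝ) ^ (-q)) ^ k * l T :=
    pow_mul_le_of_step (by positivity) hT0 (fun s hs => (hT s hs).2.1) k
  have htd : t ^ (-(d : ℝ)) * t ^ d = 1 := by
    rw [Real.rpow_neg ht0.le, Real.rpow_natCast]
    exact inv_mul_cancel₀ (by positivity)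
  calc 2 * (max Φ 1 * t ^ (-(d : ℝ)) * l t) * (2 * t) ^ d * V
      = 2 * max Φ 1 * 2 ^ d * V * l t * (t ^ (-(d : ℝ)) * t ^ d) := by rw [mul_pow]; ring
    _ = 2 * max Φ 1 * 2 ^ d * V * l t := by rw [htd, mul_one]
    _ ≤ 2 * max Φ 1 * 2 ^ d * V * (((2 : ℝ) ^ (-q)) ^ k * l T) := by gcongr
    _ ≤ (2 * max Φ 1 * 2 ^ d * V * l T + 1) * ((2 : ℝ) ^ (-q)) ^ k := by
        have : 0 < ((2 : ℝ) ^ (-q)) ^ k := by positivity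
        linarith

lemma tendsto_pow_mul_exp_neg_pow {b c β : ℝ} (hb : 0 < b) (hc : 0 < c) (hβ : 1 < β) :
    Tendsto (fun k : ℕ => b ^ k * Real.exp (-(c * β ^ k))) atTop (𝓝 0) := by
  have hβk := tendsto_pow_atTop_atTop_of_one_lt hβ
  have h1 : Tendsto (fun k : ℕ => (k : ℝ) / β ^ k) atTop (𝓝 0) := by
    simpa using tendsto_pow_const_div_const_pow_of_one_lt 1 hβ
  have h2 : Tendsto (fun k : ℕ => β ^ k * (c - (k : ℝ) / β ^ k * Real.log b)) atTop atTop := by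
    refine hβk.atTop_mul_pos hc ?_
    simpa using tendsto_const_nhds.sub (h1.mul_const (Real.log b))
  refine (Real.tendsto_exp_neg_atTop_nhds_zero.comp h2).congr fun k => ?_
  have hβ0 : β ^ k ≠ 0 := by positivity
  rw [Function.comp_apply, ← Real.exp_log (pow_pos hb k), ← Real.exp_add, Real.log_pow]
  congr 1
  field_simp
  ring

lemma LightTailed.hasPolynomialTail {P : Measure (Vec d)} {f : Vec d → ℝ} {E : Set (Vec d)}
    (hE : IsSupportCone E) (hf : HasDensityOn P f E) {γ : ℝ} (h : LightTailed E f γ) {q : ℝ}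
    (hq : 0 < q) : HasPolynomialTail P q := by
  obtain ⟨hγ, φ, l, hφ, hφc, hl, hfl⟩ := h
  have hK := isCompact_coneAnnulus hE.isClosed
  have hK0 := zero_notMem_coneAnnulus E
  have hKE : coneAnnulus E ⊆ E := fun z hz => hz.1
  obtain ⟨μ, hμ, hμφ⟩ := hK.exists_forall_le'
    (hφc.mono fun z hz => ⟨hz.1, fun h => hK0 (h ▸ hz)⟩) (a := 0)
    fun w hw => hφ w hw.1 fun h => hK0 (h ▸ hw)
  have hbound : ∀ᶠ t in atTop, ∀ w ∈ coneAnnulus E,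
      f (t • w) ≤ Real.exp (-(μ / 2 * l t)) := by
    filter_upwards [Metric.tendstoUniformlyOn_iff.1 (hfl _ hK hKE hK0) (1 / 2) (by norm_num),
      hl.eventually_pos] with t ht hlt w hw
    have hden : 0 < φ w * l t := mul_pos (hμ.trans_le (hμφ w hw)) hlt
    have h1 := ht w hw
    rw [Real.dist_eq, abs_lt] at h1
    have h2 : 1 / 2 ≤ -Real.log (f (t • w)) / (φ w * l t) := by linarith [h1.2]
    rw [le_div_iff₀ hden] at h2
    have h3 : μ * l t ≤ φ w * l t := by have := hμφ w hw; gcongr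
    have h4 : Real.log (f (t • w)) ≤ -(μ / 2 * l t) := by linarith
    exact (Real.le_exp_log _).trans (Real.exp_le_exp.2 h4)
  set β : ℝ := 2 ^ (γ / 2) with hβdef
  have hβ : 1 < β := Real.one_lt_rpow one_lt_two (half_pos hγ)
  have hstep : ∀ᶠ t in atTop, β * l t ≤ l (t * 2) := by
    have hlt : β < 2 ^ γ := Real.rpow_lt_rpow_of_exponent_lt one_lt_two (half_lt_self hγ)
    filter_upwards [(hl.2 2 two_pos).eventually_const_lt hlt, hl.eventually_pos] with t ht hlt
    exact ((lt_div_iff₀ hlt).1 ht).le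
  obtain ⟨T, hT⟩ := eventually_atTop.1 (hbound.and (hstep.and
    (hl.eventually_pos.and (eventually_gt_atTop 0))))
  have hT0 : 0 < T := (hT T le_rfl).2.2.2
  have hlT : 0 < l T := (hT T le_rfl).2.2.1
  set V := (volume (Metric.ball (0 : Vec d) 1)).toReal
  have hV : 0 ≤ V := ENNReal.toReal_nonneg
  obtain ⟨D, hD⟩ := (tendsto_pow_mul_exp_neg_pow (b := 2 ^ d * 2 ^ q) (c := μ / 2 * l T)
    (by positivity) (by positivity) hβ).bddAbove_range
  have hD0 : 0 < D := lt_of_lt_of_le (by positivity) (hD ⟨0, rfl⟩)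
  refine hasPolynomialTail_of_dyadic hq hT0 (C := D * (2 * T) ^ d * V + 1)
    (by positivity) fun k => ?_
  have hTk : T ≤ 2 ^ k * T := le_mul_of_one_le_left hT0.le (one_le_pow₀ one_le_two)
  have hlk : β ^ k * l T ≤ l (2 ^ k * T) :=
    le_pow_mul_of_step (by positivity) hT0 (fun s hs => (hT s hs).2.1) k
  refine (measure_annulus_le hE hf (hT0.trans_le hTk) (Real.exp_pos _).le (hT _ hTk).1).trans
    (ENNReal.ofReal_le_ofReal ?_)
  have hDk : (2 ^ d * 2 ^ q) ^ k * Real.exp (-(μ / 2 * l T * β ^ k)) ≤ D := hD ⟨k, rfl⟩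
  have hcancel : ((2 : ℝ) ^ q) ^ k * ((2 : ℝ) ^ (-q)) ^ k = 1 := by
    rw [← mul_pow, ← Real.rpow_add two_pos]; simp
  calc Real.exp (-(μ / 2 * l (2 ^ k * T))) * (2 * (2 ^ k * T)) ^ d * V
      ≤ Real.exp (-(μ / 2 * l T * β ^ k)) * (2 * (2 ^ k * T)) ^ d * V := by
        have : μ / 2 * l T * β ^ k ≤ μ / 2 * l (2 ^ k * T) := by
          rw [mul_assoc, mul_comm (l T)]
          gcongr
        gcongr
    _ = ((2 ^ d) ^ k * Real.exp (-(μ / 2 * l T * β ^ k))) * ((2 * T) ^ d * V) *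
          (((2 : ℝ) ^ q) ^ k * ((2 : ℝ) ^ (-q)) ^ k) := by
        rw [hcancel, show (2 : ℝ) * (2 ^ k * T) = 2 ^ k * (2 * T) by ring, mul_pow (2 ^ k),
          pow_right_comm 2 k d]
        ring
    _ = ((2 ^ d * 2 ^ q) ^ k * Real.exp (-(μ / 2 * l T * β ^ k))) * ((2 * T) ^ d * V) *
          ((2 : ℝ) ^ (-q)) ^ k := by rw [mul_pow]; ring
    _ ≤ D * ((2 * T) ^ d * V) * ((2 : ℝ) ^ (-q)) ^ k := by gcongr
    _ ≤ (D * (2 * T) ^ d * V + 1) * ((2 : ℝ) ^ (-q)) ^ k := by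
        have : 0 < ((2 : ℝ) ^ (-q)) ^ k := by positivity
        linarith

/-- Under either tail assumption the density is positive far out in the cone. The values of a
density near the origin are not constrained. -/
lemma eventually_density_pos {P : Measure (Vec d)} {f : Vec d → ℝ} {E : Set (Vec d)}
    (hf : HasDensityOn P f E) (htail : (∃ γ, LightTailed E f γ) ∨ ∃ γ, HeavyTailed E f γ)
    {C : Set (Vec d)} (hC : IsCompact C) (hCE : C ⊆ E) (hC0 : (0 : Vec d) ∉ C) :
    ∀ᶠ t : ℝ in atTop, ∀ z ∈ C, 0 < f (t • z) := by
  rcases htail with ⟨γ, -, φ, l, -, -, -, h⟩ | ⟨γ, -, φ, l, -, -, -, h⟩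
  all_goals
    filter_upwards [Metric.tendstoUniformlyOn_iff.1 (h C hC hCE hC0) 1 one_pos] with t ht z hz
    refine lt_of_le_of_ne (hf.nonneg _) fun h0 => ?_
    -- at a zero of `f` the ratio is `0` (by `log 0 = 0` in the first case), so not close to `1`
    have := ht z hz
    simp [← h0] at this

lemma measure_closedBall_pos {P : Measure (Vec d)} {f : Vec d → ℝ} {E : Set (Vec d)}
    (hf : HasDensityOn P f E) {z : Vec d} {ε : ℝ} (hε : 0 < ε)
    (h : ∀ w ∈ Metric.closedBall z ε, 0 < f w) : 0 < P (Metric.closedBall z ε) := by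
  rw [hf.eq_withDensity, withDensity_apply _ Metric.isClosed_closedBall.measurableSet,
    setLIntegral_pos_iff hf.measurable.ennreal_ofReal]
  refine (Metric.measure_closedBall_pos volume z hε).trans_le (measure_mono fun w hw => ⟨?_, hw⟩)
  simpa using h w hw

lemma measure_compl_support {P : Measure (Vec d)} {f : Vec d → ℝ} {E : Set (Vec d)}
    (hE : IsClosed E) (hf : HasDensityOn P f E) : P Eᶜ = 0 := by
  rw [hf.eq_withDensity, withDensity_apply _ hE.measurableSet.compl]
  refine setLIntegral_eq_zero hE.measurableSet.compl fun z hz => ?_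
  simp [hf.zero_off z hz]

end TailBounds

/-! ### Bounds for the optimal values -/

section Values

variable {m d K : ℕ}

/-- Robustly feasible decisions are safe on a large part of `E` around the origin, which has
interior points. -/
lemma eventually_droFeasible_subset_effective {E : Set (Vec d)} (hE : IsSupportCone E)
    (hEne : E.Nonempty) {X : Set (Vec m)} {g : Fin K → Vec m → Vec d → EReal}
    {P : Measure (Vec d)} [IsProbabilityMeasure P] {p η : ℝ} (hp : 0 < p) (hη : 0 < η) :
    ∀ᶠ α in 𝓝[>] (0 : ℝ), droFeasible X g (wassersteinBall p η P) α ⊆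
      effectiveDecisions E X g := by
  obtain ⟨κ, hκ, hfar⟩ := exists_unsafe_far_of_droFeasible (X := X) (g := g) (P := P) hp hη
  obtain ⟨z, hz⟩ : (interior E).Nonempty := by
    rw [← closure_nonempty_iff, hE.closure_interior]; exact hEne
  have hinf : Tendsto (fun α : ℝ => κ * α ^ (-(1 / p))) (𝓝[>] 0) atTop :=
    (tendsto_rpow_neg_nhdsGT_zero (by simpa using hp)).const_mul_atTop hκ
  filter_upwards [hfar, hinf.eventually_gt_atTop ‖z‖] with α hα hzα x hx
  refine ⟨hx.1, z, mem_interior.2 ⟨interior E ∩ Metric.ball 0 (κ * α ^ (-(1 / p))), ?_,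
    isOpen_interior.inter Metric.isOpen_ball, hz, by simpa using hzα⟩⟩
  rintro w ⟨hwE, hw⟩
  refine ⟨interior_subset hwE, mem_satisfied_iff.1 ?_⟩
  by_contra hsat
  exact (hα x hx w hsat).not_gt (by simpa using hw)

/-- The cost of robustly feasible decisions is at least of order `α ^ (-r / p)`: at the scale
`n ≈ α ^ (-1 / p)` a fixed direction would be unsafe for any cheaper decision. -/
lemma exists_robust_cost_lower_bound {E : Set (Vec d)} (hE : IsSupportCone E) {X : Set (Vec m)}
    (hX : IsClosed X) {g : Fin K → Vec m → Vec d → EReal} {r : ℝ} (hr : 0 < r)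
    (h0 : (0 : Vec m) ∈ X)
    (hmodel : HomogeneousModel E X g r ∨
      ∃ (ρ : ℝ) (gs : Vec m → Vec d → EReal), NonHomogeneousModel E X g r ρ gs)
    {c : Vec m → ℝ} (hc : CostModel E X g r c) (hlsc : LowerSemicontinuousOn c X)
    (hpos : ∀ x ∈ X, x ≠ 0 → 0 < c x)
    {P : Measure (Vec d)} [IsProbabilityMeasure P] {p η : ℝ} (hp : 0 < p) (hη : 0 < η) :
    ∃ v > 0, ∀ᶠ α in 𝓝[>] (0 : ℝ), ∀ x ∈ droFeasible X g (wassersteinBall p η P) α,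
      v * α ^ (-(r / p)) ≤ c x := by
  obtain ⟨z₀, hz₀E, δ, hδ, N, hun⟩ := exists_unsafe_direction hE h0 hmodel
  obtain ⟨κ, hκ, hfar⟩ := exists_unsafe_far_of_droFeasible (X := X) (g := g) (P := P) hp hη
  obtain ⟨τ, hτ, hcost⟩ := exists_mul_norm_le_cost hX hc.cone hc.homogeneous hlsc hpos
  set M := ‖z₀‖ + 1 with hM
  have hM0 : 0 < M := by positivity
  refine ⟨τ * δ * (κ / (2 * M)) ^ r, by positivity, ?_⟩
  have hinf : Tendsto (fun α : ℝ => κ / M * α ^ (-(1 / p))) (𝓝[>] 0) atTop :=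
    (tendsto_rpow_neg_nhdsGT_zero (by simpa using hp)).const_mul_atTop (by positivity)
  filter_upwards [hfar, hinf.eventually_ge_atTop (max N 2), eventually_mem_nhdsWithin] with
    α hα hαN hα0 x hx
  replace hα0 : 0 < α := hα0
  set R := κ / M * α ^ (-(1 / p)) with hR
  have hR2 : 2 ≤ R := (le_max_right _ _).trans hαN
  have hn1 : (⌊R⌋₊ : ℝ) ≤ R := Nat.floor_le (by linarith)
  have hn2 : R / 2 ≤ ⌊R⌋₊ := by linarith [Nat.lt_floor_add_one R]
  have hnN : N ≤ ⌊R⌋₊ := Nat.le_floor ((le_max_left _ _).trans hαN)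
  set n := ⌊R⌋₊
  have hn0 : (0 : ℝ) < n := by linarith
  have hnr : (0 : ℝ) < (n : ℝ) ^ r := Real.rpow_pos_of_pos hn0 r
  have hsat : (n : ℝ) • z₀ ∈ satisfied g x := by
    by_contra hsat
    have h1 := hα x hx _ hsat
    rw [norm_smul, Real.norm_of_nonneg hn0.le] at h1
    have h2 : κ * α ^ (-(1 / p)) = R * M := by rw [hR]; field_simp
    have h3 : (n : ℝ) * ‖z₀‖ ≤ R * ‖z₀‖ := by gcongr
    rw [h2, hM] at h1
    linarith
  have hy : δ ≤ ‖((n : ℝ) ^ r)⁻¹ • x‖ := by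
    by_contra! hlt
    refine hun n hnN _ (hc.cone x hx.1 _ (inv_pos.2 hnr)) hlt z₀ hz₀E (by simpa using hδ) ?_
    rwa [smul_inv_smul₀ hnr.ne']
  rw [norm_smul, norm_inv, Real.norm_of_nonneg hnr.le, inv_mul_eq_div, le_div_iff₀ hnr] at hy
  have hRr : (R / 2) ^ r = (κ / (2 * M)) ^ r * α ^ (-(r / p)) := by
    rw [show R / 2 = κ / (2 * M) * α ^ (-(1 / p)) by rw [hR]; field_simp,
      Real.mul_rpow (by positivity) (by positivity), ← Real.rpow_mul hα0.le]
    congr 2; ring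
  calc τ * δ * (κ / (2 * M)) ^ r * α ^ (-(r / p)) = τ * (δ * (R / 2) ^ r) := by rw [hRr]; ring
    _ ≤ τ * (δ * (n : ℝ) ^ r) := by gcongr
    _ ≤ τ * ‖x‖ := by gcongr
    _ ≤ c x := hcost x hx.1

/-- Decisions feasible for the nominal problem become arbitrarily expensive: at decisions of
bounded cost, a fixed set of positive probability is unsafe. -/
lemma eventually_lt_cost_of_ccpFeasible (hd : 0 < d) {E : Set (Vec d)} (hE : IsSupportCone E)
    {X : Set (Vec m)} (hX : IsClosed X) {g : Fin K → Vec m → Vec d → EReal} {r : ℝ} (hr : 0 < r)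
    (h0 : (0 : Vec m) ∈ X)
    (hmodel : HomogeneousModel E X g r ∨
      ∃ (ρ : ℝ) (gs : Vec m → Vec d → EReal), NonHomogeneousModel E X g r ρ gs)
    {c : Vec m → ℝ} (hc : CostModel E X g r c) (hlsc : LowerSemicontinuousOn c X)
    (hpos : ∀ x ∈ X, x ≠ 0 → 0 < c x)
    {P : Measure (Vec d)} [IsProbabilityMeasure P] {f : Vec d → ℝ} (hf : HasDensityOn P f E)
    (htail : (∃ γ, LightTailed E f γ) ∨ ∃ γ, HeavyTailed E f γ) (B : ℝ) :
    ∀ᶠ α in 𝓝[>] (0 : ℝ), ∀ x ∈ ccpFeasible X g P α, B < c x := by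
  have : Nonempty (Fin d) := ⟨⟨0, hd⟩⟩
  obtain ⟨z₀, hz₀E, δ, hδ, N, hun⟩ := exists_unsafe_direction hE h0 hmodel
  obtain ⟨τ, hτ, hcost⟩ := exists_mul_norm_le_cost hX hc.cone hc.homogeneous hlsc hpos
  have hopen : IsOpen (interior E ∩ Metric.ball z₀ δ) := isOpen_interior.inter Metric.isOpen_ball
  have hne : (interior E ∩ Metric.ball z₀ δ).Nonempty := by
    rw [← hE.closure_interior] at hz₀E
    rw [Set.inter_comm]
    exact mem_closure_iff.1 hz₀E _ Metric.isOpen_ball (Metric.mem_ball_self hδ)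
  obtain ⟨z₁, hz₁, hz₁0⟩ := (dense_compl_singleton (0 : Vec d)).inter_open_nonempty _ hopen hne
  obtain ⟨ε, hε, hball⟩ := Metric.nhds_basis_closedBall.mem_iff.1
    ((hopen.inter isOpen_compl_singleton).mem_nhds ⟨hz₁, hz₁0⟩)
  have hden := eventually_density_pos hf htail (isCompact_closedBall z₁ ε)
    (fun w hw => interior_subset (hball hw).1.1) fun h => (hball h).2 rfl
  have hpow : Tendsto (fun t : ℝ => δ * t ^ r) atTop atTop :=
    (tendsto_rpow_atTop hr).const_mul_atTop hδ
  obtain ⟨n, ⟨hn, hnB, hn0⟩, hnN⟩ := ((tendsto_natCast_atTop_atTop (R := ℝ)).eventually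
    (hden.and ((hpow.eventually_gt_atTop (B / τ)).and (eventually_gt_atTop 0)))
      |>.and (eventually_ge_atTop N)).exists
  have hscale : ∀ w ∈ Metric.closedBall ((n : ℝ) • z₁) (n * ε),
      ∃ w' ∈ Metric.closedBall z₁ ε, w = (n : ℝ) • w' := by
    intro w hw
    refine ⟨(n : ℝ)⁻¹ • w, ?_, (smul_inv_smul₀ hn0.ne' w).symm⟩
    rw [Metric.mem_closedBall] at hw ⊢
    rw [← smul_inv_smul₀ hn0.ne' w, dist_smul₀, Real.norm_of_nonneg hn0.le] at hw
    exact le_of_mul_le_mul_left hw hn0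
  have hPpos : 0 < P (Metric.closedBall ((n : ℝ) • z₁) (n * ε)) := by
    refine measure_closedBall_pos hf (by positivity) fun w hw => ?_
    obtain ⟨w', hw', rfl⟩ := hscale w hw
    exact hn w' hw'
  have hnr : (0 : ℝ) < (n : ℝ) ^ r := Real.rpow_pos_of_pos hn0 r
  have hb : 0 < (P (Metric.closedBall ((n : ℝ) • z₁) (n * ε))).toReal :=
    ENNReal.toReal_pos hPpos.ne' (measure_ne_top _ _)
  filter_upwards [nhdsWithin_le_nhds (gt_mem_nhds hb), nhdsWithin_le_nhds (gt_mem_nhds one_pos)]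
    with α hαb hα1 x hx
  by_contra! hcx
  have hxδ : ‖((n : ℝ) ^ r)⁻¹ • x‖ < δ := by
    rw [norm_smul, norm_inv, Real.norm_of_nonneg hnr.le, inv_mul_eq_div, div_lt_iff₀ hnr]
    refine lt_of_le_of_lt ?_ hnB
    rw [le_div_iff₀ hτ, mul_comm]
    exact (hcost x hx.1).trans hcx
  have hdisj : Disjoint (satisfied g x) (Metric.closedBall ((n : ℝ) • z₁) (n * ε)) := by
    refine Set.disjoint_left.2 fun w hw hwb => ?_
    obtain ⟨w', hw', rfl⟩ := hscale w hwb
    refine hun n hnN _ (hc.cone x hx.1 _ (inv_pos.2 hnr)) hxδ w'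
      (interior_subset (hball hw').1.1) (hball hw').1.2 ?_
    rwa [smul_inv_smul₀ hnr.ne']
  have hsum : ENNReal.ofReal
      (1 - α + (P (Metric.closedBall ((n : ℝ) • z₁) (n * ε))).toReal) ≤ 1 := by
    rw [ENNReal.ofReal_add (by linarith) hb.le, ENNReal.ofReal_toReal (measure_ne_top _ _)]
    refine (add_le_add_left hx.2 _).trans ?_
    rw [← measure_union hdisj Metric.isClosed_closedBall.measurableSet]
    exact prob_le_one
  rw [ENNReal.ofReal_le_one] at hsum
  linarith

/-- A polynomial tail of order `q` makes the decision `n ^ r • x` with `n ≈ α ^ (-1 / q)` feasible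
for the nominal problem. -/
lemma exists_ccpValue_upper_bound {E : Set (Vec d)} (hE : IsSupportCone E)
    {X : Set (Vec m)} {g : Fin K → Vec m → Vec d → EReal} {r : ℝ} (hr : 0 < r)
    (hmodel : HomogeneousModel E X g r ∨
      ∃ (ρ : ℝ) (gs : Vec m → Vec d → EReal), StrongNonHomogeneousModel E X g r ρ gs)
    {c : Vec m → ℝ} (hc : CostModel E X g r c) (hnonneg : ∀ x ∈ X, 0 ≤ c x)
    {P : Measure (Vec d)} [IsProbabilityMeasure P] {f : Vec d → ℝ} (hf : HasDensityOn P f E)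
    {x : Vec m} (hx : x ∈ effectiveDecisions E X g) (hcx : 0 < c x) {q : ℝ} (hq : 0 < q)
    (htail : HasPolynomialTail P q) :
    ∃ C > 0, ∀ᶠ α in 𝓝[>] (0 : ℝ), ccpValue X g c P α ≤ C * α ^ (-(r / q)) := by
  obtain ⟨A, hA, hPA⟩ := htail
  obtain ⟨δ, hδ, N, hsafe⟩ := exists_safe_radius hE hmodel hx
  refine ⟨(2 / δ * A ^ (1 / q)) ^ r * c x, by positivity, ?_⟩
  have hinf : Tendsto (fun α : ℝ => A ^ (1 / q) * α ^ (-(1 / q))) (𝓝[>] 0) atTop :=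
    (tendsto_rpow_neg_nhdsGT_zero (by simpa using hq)).const_mul_atTop (by positivity)
  filter_upwards [hinf.eventually hPA, hinf.eventually_ge_atTop (max δ (δ * N)),
    eventually_mem_nhdsWithin] with α hαP hαN hα0
  replace hα0 : 0 < α := hα0
  set s := A ^ (1 / q) * α ^ (-(1 / q)) with hs
  have hsq : A * s ^ (-q) = α := by
    rw [hs, Real.mul_rpow (by positivity) (by positivity), ← Real.rpow_mul hA.le,
      ← Real.rpow_mul hα0.le, show 1 / q * -q = -1 by field_simp,
      show -(1 / q) * -q = 1 by field_simp, Real.rpow_neg_one, Real.rpow_one,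
      mul_inv_cancel_left₀ hA.ne']
  rw [hsq] at hαP
  have hsδ : 1 ≤ s / δ := (one_le_div hδ).2 ((le_max_left _ _).trans hαN)
  have hsN : (N : ℝ) ≤ s / δ := by
    rw [le_div_iff₀ hδ, mul_comm]; exact (le_max_right _ _).trans hαN
  have hn1 : s / δ ≤ ⌈s / δ⌉₊ := Nat.le_ceil _
  have hn2 : (⌈s / δ⌉₊ : ℝ) ≤ 2 / δ * s := by
    have := Nat.ceil_lt_add_one (a := s / δ) (by linarith)
    have h2 : 2 / δ * s = s / δ + s / δ := by ring
    linarith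
  set n := ⌈s / δ⌉₊
  have hnN : N ≤ n := by exact_mod_cast hsN.trans hn1
  have hn0 : (0 : ℝ) < n := by linarith
  have hnr : (0 : ℝ) < (n : ℝ) ^ r := Real.rpow_pos_of_pos hn0 r
  have hsn : s ≤ δ * n := by rwa [div_le_iff₀' hδ] at hn1
  have hfeas : (n : ℝ) ^ r • x ∈ ccpFeasible X g P α := by
    refine ⟨hc.cone x hx.1 _ hnr, ?_⟩
    rw [ENNReal.ofReal_sub _ hα0.le, ENNReal.ofReal_one, tsub_le_iff_right, ← measure_univ (μ := P)]
    have hcompl : (satisfied g ((n : ℝ) ^ r • x))ᶜ ⊆ Eᶜ ∪ {z | s ≤ ‖z‖} := by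
      intro z hz
      by_contra hcon
      simp only [Set.mem_union, Set.mem_compl_iff, not_or, not_not, Set.mem_ofPred_eq,
        not_le] at hcon
      exact hz (hsafe n hnN z hcon.1 (hcon.2.trans_le hsn))
    refine (measure_univ_le_add_compl (satisfied g ((n : ℝ) ^ r • x))).trans ?_
    gcongr
    calc P (satisfied g ((n : ℝ) ^ r • x))ᶜ ≤ P Eᶜ + P {z | s ≤ ‖z‖} :=
          (measure_mono hcompl).trans (measure_union_le _ _)
      _ ≤ ENNReal.ofReal α := by rwa [measure_compl_support hE.isClosed hf, zero_add]
  have hbdd : BddBelow (c '' ccpFeasible X g P α) :=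
    ⟨0, by rintro _ ⟨y, hy, rfl⟩; exact hnonneg y hy.1⟩
  calc ccpValue X g c P α ≤ c ((n : ℝ) ^ r • x) := csInf_le hbdd ⟨_, hfeas, rfl⟩
    _ = (n : ℝ) ^ r * c x := hc.homogeneous x hx.1 _ hnr
    _ ≤ (2 / δ * s) ^ r * c x := by gcongr
    _ = (2 / δ * A ^ (1 / q)) ^ r * c x * α ^ (-(r / q)) := by
        rw [hs, ← mul_assoc, Real.mul_rpow (by positivity) (by positivity),
          ← Real.rpow_mul hα0.le, show -(1 / q) * r = -(r / q) by ring]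
        ring

/-- Power bounds `u ≥ v α ^ (-a)` and `1 < w ≤ C α ^ (-b)` bound the ratio of the logarithms from
below by any `β < a / b`. -/
lemma eventually_le_log_div_log {u w : ℝ → ℝ} {a b v C β : ℝ} (hv : 0 < v) (hC : 0 < C)
    (hu : ∀ᶠ α in 𝓝[>] (0 : ℝ), v * α ^ (-a) ≤ u α)
    (hw : ∀ᶠ α in 𝓝[>] (0 : ℝ), w α ≤ C * α ^ (-b))
    (hw1 : ∀ᶠ α in 𝓝[>] (0 : ℝ), 1 < w α) (hβ : 0 ≤ β) (hab : β * b < a) :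
    ∀ᶠ α in 𝓝[>] (0 : ℝ), β ≤ Real.log (u α) / Real.log (w α) := by
  have hlog : Tendsto (fun α : ℝ => -Real.log α) (𝓝[>] 0) atTop :=
    tendsto_neg_atBot_atTop.comp Real.tendsto_log_nhdsGT_zero
  have hlarge := (hlog.const_mul_atTop (sub_pos.2 hab)).eventually_ge_atTop
    (β * Real.log C - Real.log v)
  filter_upwards [hu, hw, hw1, hlarge, eventually_mem_nhdsWithin] with α h1 h2 h3 h4 h5
  replace h5 : 0 < α := h5
  rw [le_div_iff₀ (Real.log_pos h3)]
  have hlu : Real.log v + -a * Real.log α ≤ Real.log (u α) := by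
    rw [← Real.log_rpow h5, ← Real.log_mul hv.ne' (by positivity)]
    exact Real.log_le_log (by positivity) h1
  have hlw : Real.log (w α) ≤ Real.log C + -b * Real.log α := by
    rw [← Real.log_rpow h5, ← Real.log_mul hC.ne' (by positivity)]
    exact Real.log_le_log (by linarith) h2
  have := mul_le_mul_of_nonneg_left hlw hβ
  linarith

end Values

end CCP

theorem mainTheorem5 {m d K : ℕ} (hd : 0 < d) (hK : 0 < K)
    (E : Set (CCP.Vec d)) (hE : CCP.IsSupportCone E)
    (X : Set (CCP.Vec m)) (hX : IsClosed X)
    (g : Fin K → CCP.Vec m → CCP.Vec d → EReal)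
    (hg : ∀ k, LowerSemicontinuous fun q : CCP.Vec m × CCP.Vec d => g k q.1 q.2)
    (r : ℝ)
    (hmodel : CCP.HomogeneousModel E X g r ∨
      ∃ (ρ : ℝ) (gs : CCP.Vec m → CCP.Vec d → EReal), CCP.NonHomogeneousModel E X g r ρ gs)
    (c : CCP.Vec m → ℝ) (hc : CCP.CostModel E X g r c)
    (hc_lsc : LowerSemicontinuousOn c X) (hc_pos : ∀ x ∈ X, x ≠ 0 → 0 < c x)
    (P : Measure (CCP.Vec d)) [IsProbabilityMeasure P]
    (f : CCP.Vec d → ℝ) (hf : CCP.HasDensityOn P f E)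
    (p : ℝ) (hp : 1 ≤ p) (η : ℝ) (hη : 0 < η)
    (htail : (∃ γ, CCP.LightTailed E f γ) ∨ ∃ γ, CCP.HeavyTailed E f γ ∧ p < γ)
    (xW : ℝ → CCP.Vec m)
    (hxW : ∀ᶠ α in 𝓝[>] (0 : ℝ),
      CCP.IsDroOptimal X g c (CCP.wassersteinBall p η P) α (xW α)) :
    (∀ ε > 0, ∃ v > 0, ∀ᶠ α in 𝓝[>] (0 : ℝ), v * α ^ (-(r / p - ε)) ≤ c (xW α)) ∧
    ((CCP.HomogeneousModel E X g r ∨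
        ∃ (ρ : ℝ) (gs : CCP.Vec m → CCP.Vec d → EReal),
          CCP.StrongNonHomogeneousModel E X g r ρ gs) →
      (∀ᶠ α in 𝓝[>] (0 : ℝ), 1 < CCP.ccpValue X g c P α) ∧
      (∀ γ, CCP.LightTailed E f γ →
        liminf (fun α : ℝ =>
          ((Real.log (c (xW α)) / Real.log (CCP.ccpValue X g c P α) : ℝ) : EReal))
          (𝓝[>] (0 : ℝ)) = ⊤) ∧
      (∀ γ, CCP.HeavyTailed E f γ → p < γ →
        ((γ / p : ℝ) : EReal) ≤ liminf (fun α : ℝ =>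
          ((Real.log (c (xW α)) / Real.log (CCP.ccpValue X g c P α) : ℝ) : EReal))
          (𝓝[>] (0 : ℝ)))) := by
  have hp0 : 0 < p := by linarith
  have hEne : E.Nonempty := by
    by_contra hemp
    have h := CCP.measure_compl_support hE.isClosed hf
    rw [Set.not_nonempty_iff_eq_empty.1 hemp, Set.compl_empty, measure_univ] at h
    exact one_ne_zero h
  obtain ⟨α₀, hx₀, hα₀⟩ :=
    (hxW.and (CCP.eventually_droFeasible_subset_effective (X := X) (g := g) (P := P)
      hE hEne hp0 hη)).exists
  -- a single effective decision fixes the sign of `r` and serves as the ray for the nominal problem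
  have heff := hα₀ hx₀.1
  obtain ⟨hr, hcx⟩ := CCP.exponent_pos_of_effective hc hc_pos heff
  have h0 := CCP.zero_mem_of_cone hX ⟨_, heff.1⟩ hc.cone
  have hnonneg : ∀ x ∈ X, 0 ≤ c x := by
    obtain ⟨τ, hτ, hcost⟩ := CCP.exists_mul_norm_le_cost hX hc.cone hc.homogeneous hc_lsc hc_pos
    exact fun x hx => le_trans (by positivity) (hcost x hx)
  obtain ⟨v, hv, hlow⟩ := CCP.exists_robust_cost_lower_bound (P := P) hE hX hr h0 hmodel hc hc_lsc
    hc_pos hp0 hη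
  have hlow' : ∀ᶠ α in 𝓝[>] (0 : ℝ), v * α ^ (-(r / p)) ≤ c (xW α) :=
    (hlow.and hxW).mono fun α h => h.1 _ h.2.1
  refine ⟨fun ε hε => ⟨v, hv, ?_⟩, fun hstrong => ?_⟩
  -- the bound holds even without the loss `ε` in the exponent
  · filter_upwards [hlow', nhdsWithin_le_nhds (gt_mem_nhds one_pos), eventually_mem_nhdsWithin]
      with α h1 h2 h3
    refine le_trans ?_ h1
    have := Real.rpow_le_rpow_of_exponent_ge h3 h2.le
      (show -(r / p) ≤ -(r / p - ε) by linarith)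
    gcongr
  have hone : ∀ᶠ α in 𝓝[>] (0 : ℝ), 1 < CCP.ccpValue X g c P α := by
    filter_upwards [hxW, CCP.eventually_lt_cost_of_ccpFeasible hd hE hX hr h0 hmodel hc hc_lsc
      hc_pos hf (htail.imp_right fun ⟨γ, h⟩ => ⟨γ, h.1⟩) 2] with α hα h2
    have : 2 ≤ CCP.ccpValue X g c P α := by
      refine le_csInf ⟨_, _, CCP.droFeasible_subset_ccpFeasible hp0 hα.1, rfl⟩ ?_
      rintro _ ⟨x, hx, rfl⟩
      exact (h2 x hx).le
    linarith
  have hratio : ∀ β q : ℝ, 0 ≤ β → β * p < q → CCP.HasPolynomialTail P q →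
      (β : EReal) ≤ liminf (fun α : ℝ =>
        ((Real.log (c (xW α)) / Real.log (CCP.ccpValue X g c P α) : ℝ) : EReal))
        (𝓝[>] (0 : ℝ)) := by
    intro β q hβ hβq hq
    have hq0 : 0 < q := lt_of_le_of_lt (by positivity) hβq
    obtain ⟨C, hC, hup⟩ := CCP.exists_ccpValue_upper_bound hE hr hstrong hc hnonneg hf heff hcx
      hq0 hq
    have hab : β * (r / q) < r / p := by
      rw [← mul_div_assoc, div_lt_div_iff₀ hq0 hp0]
      calc β * r * p = r * (β * p) := by ring
        _ < r * q := by gcongr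
    refine le_liminf_of_le (h := ?_)
    filter_upwards [CCP.eventually_le_log_div_log hv hC hlow' hup hone hβ hab] with α hα
    exact EReal.coe_le_coe_iff.2 hα
  refine ⟨hone, fun γ hγ => ?_, fun γ hγ hpγ => ?_⟩
  · refine top_le_iff.1 (EReal.ge_of_forall_gt_iff_ge.1 fun b _ => ?_)
    have hmax : 0 ≤ max b 0 := le_max_right _ _
    refine le_trans (EReal.coe_le_coe_iff.2 (le_max_left b 0)) (hratio _ (max b 0 * p + 1) hmax
      (by linarith) (hγ.hasPolynomialTail hE hf (by positivity)))
  · refine EReal.ge_of_forall_gt_iff_ge.1 fun b hb => ?_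
    have hmax : 0 ≤ max b 0 := le_max_right _ _
    have hlt : max b 0 < γ / p := max_lt (EReal.coe_lt_coe_iff.1 hb) (div_pos (hp0.trans hpγ) hp0)
    rw [lt_div_iff₀ hp0] at hlt
    have hmp : 0 ≤ max b 0 * p := by positivity
    exact le_trans (EReal.coe_le_coe_iff.2 (le_max_left b 0)) (hratio _ ((max b 0 * p + γ) / 2) hmax
      (by linarith) (hγ.hasPolynomialTail hE hf (by linarith) (by linarith)))
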